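/- Let $0<\alpha<1$ and let $T:[0,1]\to[0,1]$, $T(x)=x+x^{1+\alpha} \bmod 1$, be the Manneville--Pomeau map. Let $I_0=\{x\in[0,1]: x+x^{1+\alpha}<1\}$ and $I_1=[0,1]\setminus I_0$ be its two intervals of monotonicity; for a word $a_1\dots a_n\in\{0,1\}^n$ let $I_{a_1\dots a_n}=I_{a_1}\cap T^{-1}I_{a_2}\cap\dots\cap T^{-(n-1)}I_{a_n}$ be the corresponding $n$-cylinder, and for $x\in[0,1]$ let $x_j\in\{0,1\}$ be the symbol with $T^{j-1}x\in I_{x_j}$, $j\ge 1$. For $n\ge1$ define the hitting and return times (with $\inf\emptyset=\infty$) $$w_n(x,y)=\inf\{j\ge1: y_j\dots y_{j+n-1}=x_1\dots x_n\},\qquad r_n(x)=\inf\{k\ge2: x_k\dots x_{k+n-1}=x_1\dots x_n\}.$$ Let $\mu$ be a $T$-invariant Borel probability measure on $[0,1]$ that is absolutely continuous with respect to Lebesgue measure. For $q\in\mathbb R$ put $$\mathcal W_n(q)=\frac1n\log\int w_n^q\,d(\mu\times\mu),\qquad \mathcal R_n(q)=\frac1n\log\int r_n^q\,d\mu,$$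 $$\mathcal M(q)=\lim_{n\to\infty}\frac1n\log\sum_{a_1\dots a_n}\mu(I_{a_1\dots a_n})^{1-q}.$$ Then: (1) for every $q\ge \frac1\alpha$, $\mathcal W_n(q)=\infty$ for all $n\ge1$, hence $\mathcal W(q)=\lim_{n\to\infty}\mathcal W_n(q)=\infty$; (2) for every $q\in\mathbb R$, the limit $\mathcal M(q)$ exists and is finite; (3) for every $q\ge\frac1\alpha+1$, $\mathcal R_n(q)=\infty$ for all $n\ge1$, hence $\mathcal R(q)=\lim_{n\to\infty}\mathcal R_n(q)=\infty$. -/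

import Mathlib

open MeasureTheory Filter Topology Set
open scoped ENNReal

namespace MannevillePomeau

noncomputable section

/-- The Manneville-Pomeau map `x ↦ x + x ^ (1 + α) mod 1` (only its values on `[0, 1]` matter). -/
def mpMap (α : ℝ) (x : ℝ) : ℝ := Int.fract (x + x ^ (1 + α))

/-- The two intervals of monotonicity of the map in `[0, 1]`: on the first the map is
`x + x ^ (1 + α)`, on (the interior of) the second it is `x + x ^ (1 + α) - 1`. -/
def branch (α : ℝ) : Fin 2 → Set ℝ
  | 0 => {x | x ∈ Icc (0 : ℝ) 1 ∧ x + x ^ (1 + α) < 1}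
  | 1 => {x | x ∈ Icc (0 : ℝ) 1 ∧ 1 ≤ x + x ^ (1 + α)}

/-- The cylinder `I_{a 0} ∩ T⁻¹ I_{a 1} ∩ ⋯ ∩ T⁻⁽ⁿ⁻¹⁾ I_{a (n-1)}`. -/
def cylinder (α : ℝ) {n : ℕ} (a : Fin n → Fin 2) : Set ℝ :=
  {x | x ∈ Icc (0 : ℝ) 1 ∧ ∀ k : Fin n, (mpMap α)^[(k : ℕ)] x ∈ branch α (a k)}

/-- The symbol sequence of `x`, indexed from `0`: its `k`-th entry is the index of the interval
of monotonicity that contains `T^k x`. -/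
def code (α : ℝ) (x : ℝ) (k : ℕ) : Fin 2 :=
  if (mpMap α)^[k] x + ((mpMap α)^[k] x) ^ (1 + α) < 1 then 0 else 1

theorem iterate_mem_Icc (α : ℝ) {x : ℝ} (hx : x ∈ Icc (0 : ℝ) 1) (k : ℕ) :
    (mpMap α)^[k] x ∈ Icc (0 : ℝ) 1 := by
  cases k with
  | zero => simpa using hx
  | succ k =>
    rw [Function.iterate_succ_apply']
    exact ⟨Int.fract_nonneg _, (Int.fract_lt_one _).le⟩

/-- On `[0, 1]` the symbol sequence is the one read off the two intervals of monotonicity. -/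
theorem code_eq_iff (α : ℝ) {x : ℝ} (hx : x ∈ Icc (0 : ℝ) 1) (k : ℕ) (i : Fin 2) :
    code α x k = i ↔ (mpMap α)^[k] x ∈ branch α i := by
  have h := iterate_mem_Icc α hx k
  unfold code
  fin_cases i <;> by_cases hlt : (mpMap α)^[k] x + ((mpMap α)^[k] x) ^ (1 + α) < 1
  · simp [branch, hlt, h.1, h.2]
  · simp [branch, hlt]
  · simp [branch, hlt]
  · simp [branch, hlt, h.1, h.2, not_lt.mp hlt]

/-- A point of `[0, 1]` lies in the cylinder of a word iff its symbol sequence starts with it. -/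
theorem mem_cylinder_iff (α : ℝ) {n : ℕ} (a : Fin n → Fin 2) {x : ℝ} (hx : x ∈ Icc (0 : ℝ) 1) :
    x ∈ cylinder α a ↔ ∀ k : Fin n, code α x k = a k := by
  simp only [cylinder, Set.mem_ofPred_eq, hx, true_and, code_eq_iff α hx]

/-- The hitting time `w_n(x, y) = inf {j ≥ 1 : y_j ⋯ y_{j+n-1} = x_1 ⋯ x_n}`, with `inf ∅ = ∞`.
The symbol `y_j` is `code α y (j - 1)`; the infimum is over `j = m + 1` with `m ≥ 0`. -/
def hittingTime (α : ℝ) (n : ℕ) (x y : ℝ) : ℝ≥0∞ :=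
  ⨅ (m : ℕ) (_ : ∀ i < n, code α y (m + i) = code α x i), ((m + 1 : ℕ) : ℝ≥0∞)

/-- The return time `r_n(x) = inf {k ≥ 2 : x_k ⋯ x_{k+n-1} = x_1 ⋯ x_n}`, with `inf ∅ = ∞`.
The infimum is over `k = m + 1` with `m ≥ 1`. -/
def returnTime (α : ℝ) (n : ℕ) (x : ℝ) : ℝ≥0∞ :=
  ⨅ (m : ℕ) (_ : 1 ≤ m ∧ ∀ i < n, code α x (m + i) = code α x i), ((m + 1 : ℕ) : ℝ≥0∞)

/-- `W_n(q) = (1 / n) log ∫ w_n(x, y) ^ q d(μ × μ)(x, y)`, in the extended reals. -/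
def hittingSpectrum (α : ℝ) (μ : Measure ℝ) (n : ℕ) (q : ℝ) : EReal :=
  ENNReal.log (∫⁻ p : ℝ × ℝ, hittingTime α n p.1 p.2 ^ q ∂(μ.prod μ)) / (n : EReal)

/-- `R_n(q) = (1 / n) log ∫ r_n(x) ^ q dμ(x)`, in the extended reals. -/
def returnSpectrum (α : ℝ) (μ : Measure ℝ) (n : ℕ) (q : ℝ) : EReal :=
  ENNReal.log (∫⁻ x, returnTime α n x ^ q ∂μ) / (n : EReal)

/-- `(1 / n) log ∑ μ(I_a) ^ (1 - q)`, the sum being over all `n`-cylinders `I_a`, in the extended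
reals; `M(q)` is its limit as `n → ∞`. -/
def renyiSpectrum (α : ℝ) (μ : Measure ℝ) (n : ℕ) (q : ℝ) : EReal :=
  ENNReal.log (∑ a : Fin n → Fin 2, μ (cylinder α a) ^ (1 - q)) / (n : EReal)

end

end MannevillePomeau

namespace MannevillePomeau

noncomputable section

/-! Everything is read off the inverse branches `wordInv` of the iterates. Since `lift` is convex
and increasing, each branch is concave on `[0, 1]`, and its derivative `wordDeriv` is largest at
`0`. Write `F t = μ [0, t)` and `c_n = zeroEnd α n`.

By invariance, `F` is a sum of masses carried by the inverse branches. Replacing the density by a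
constant on each short cylinder approximates `F` by nonnegative combinations of concave functions,
so `F` is concave (`concaveOn_measureReal_Ico`). Hence `μ` dominates a multiple `κ > 0` of length on
`[0, 1]` (`exists_le_measureReal_Ico`), while on an `n`-cylinder it is at most length divided by
`c_n` (`measureReal_Ico_wordInv_le_div`).

Infinite moments: `c_k ≥ (1 + k) ^ (-1/α)`. A point coded `1 0 ⋯ 0` with `k` zeros needs more than
`k` steps to return, and such points have mass at least a multiple of `c_k`. For hitting times, let
`x` begin with `1` and `y` with `k` zeros; the latter has mass at least of order `k * c_{2k}`. At
and above the critical exponents these events alone force the moments to grow linearly in `k`.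

Rényi limit: the distortion of an `n`-cylinder is at most `exp (distortion α n)` with `distortion α
n = o(n)`, and `1 / c_n` obeys the same bound. So the measure of a cylinder may be replaced by the
derivative of its branch at `0`. As that derivative is maximal at `0`, the sums of its powers are
sub- or supermultiplicative, and Fekete's lemma applies. -/

/-- The Manneville-Pomeau map before reduction modulo `1`. -/
def lift (α x : ℝ) : ℝ := x + x ^ (1 + α)

/-- The derivative of `lift`. -/
def liftDeriv (α x : ℝ) : ℝ := 1 + (1 + α) * x ^ α

/-- The inverse of `lift` on `[0, ∞)`. -/
def invLift (α : ℝ) : ℝ → ℝ := Function.invFunOn (lift α) (Ici 0)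

/-! ### The convex lift of the map and its concave inverse -/

section Lift

variable {α : ℝ}

theorem lift_zero (hα : 0 < α) : lift α 0 = 0 := by
  simp [lift, Real.zero_rpow (by linarith : 1 + α ≠ 0)]

theorem lift_one : lift α 1 = 2 := by
  simp [lift]; norm_num

theorem lift_strictMonoOn (hα : 0 < α) : StrictMonoOn (lift α) (Ici 0) := by
  intro x hx y hy hxy
  have := Real.rpow_lt_rpow hx hxy (by linarith : 0 < 1 + α)
  simp only [lift]; linarith

theorem continuous_lift (hα : 0 < α) : Continuous (lift α) :=
  continuous_id.add (Real.continuous_rpow_const (by linarith))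

theorem convexOn_lift (hα : 0 < α) : ConvexOn ℝ (Ici 0) (lift α) :=
  (convexOn_id (convex_Ici 0)).add (convexOn_rpow (by linarith))

theorem le_lift {x : ℝ} (hx : 0 ≤ x) : x ≤ lift α x := by
  have := Real.rpow_nonneg hx (1 + α)
  simp only [lift]; linarith

theorem lift_sub_le (hα : 0 < α) {x y : ℝ} (hx : 0 ≤ x) (hxy : x ≤ y) :
    lift α (y - x) ≤ lift α y - lift α x := by
  have := Real.add_rpow_le_rpow_add hx (sub_nonneg.2 hxy) (by linarith : 1 ≤ 1 + α)
  rw [add_sub_cancel] at this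
  simp only [lift]; linarith

theorem hasDerivAt_lift (hα : 0 < α) (x : ℝ) : HasDerivAt (lift α) (liftDeriv α x) x := by
  have := (hasDerivAt_id x).add
    (Real.hasDerivAt_rpow_const (x := x) (p := 1 + α) (Or.inr (by linarith)))
  rw [show 1 + α - 1 = α by ring] at this
  exact this

theorem liftDeriv_mul_le (hα : 0 < α) {x y : ℝ} (hx : 0 ≤ x) (hxy : x ≤ y) :
    liftDeriv α x * (y - x) ≤ lift α y - lift α x := by
  rcases hxy.eq_or_lt with rfl | h
  · simp
  have := (convexOn_lift hα).le_slope_of_hasDerivAt hx (hx.trans hxy) h (hasDerivAt_lift hα x)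
  rwa [slope_def_field, le_div_iff₀ (sub_pos.2 h)] at this

theorem le_liftDeriv_mul (hα : 0 < α) {x y : ℝ} (hx : 0 ≤ x) (hxy : x ≤ y) :
    lift α y - lift α x ≤ liftDeriv α y * (y - x) := by
  rcases hxy.eq_or_lt with rfl | h
  · simp
  have := (convexOn_lift hα).slope_le_of_hasDerivAt hx (hx.trans hxy) h (hasDerivAt_lift hα y)
  rwa [slope_def_field, div_le_iff₀ (sub_pos.2 h)] at this

theorem one_le_liftDeriv (hα : 0 < α) {x : ℝ} (hx : 0 ≤ x) : 1 ≤ liftDeriv α x := by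
  have := Real.rpow_nonneg hx α
  simp only [liftDeriv]; nlinarith

theorem liftDeriv_pos (hα : 0 < α) {x : ℝ} (hx : 0 ≤ x) : 0 < liftDeriv α x :=
  zero_lt_one.trans_le (one_le_liftDeriv hα hx)

theorem liftDeriv_mono (hα : 0 < α) {x y : ℝ} (hx : 0 ≤ x) (hxy : x ≤ y) :
    liftDeriv α x ≤ liftDeriv α y := by
  have := Real.rpow_le_rpow hx hxy hα.le
  simp only [liftDeriv]; nlinarith

theorem liftDeriv_le_three (hα : α ∈ Ioo (0 : ℝ) 1) {x : ℝ} (hx : x ∈ Icc (0 : ℝ) 1) :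
    liftDeriv α x ≤ 3 := by
  refine (liftDeriv_mono hα.1 hx.1 hx.2).trans ?_
  simp only [liftDeriv, Real.one_rpow]
  linarith [hα.2]

/-- Subadditivity of `t ^ α` for `α ≤ 1` makes the derivative Hölder; the constant `2` bounds `1 +
α`. -/
theorem liftDeriv_sub_le (hα : α ∈ Ioo (0 : ℝ) 1) {x y : ℝ} (hx : 0 ≤ x) (hxy : x ≤ y) :
    liftDeriv α y - liftDeriv α x ≤ 2 * (y - x) ^ α := by
  have h := Real.rpow_add_le_add_rpow hx (sub_nonneg.2 hxy) hα.1.le hα.2.le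
  rw [add_sub_cancel] at h
  have h0 := Real.rpow_nonneg (sub_nonneg.2 hxy) α
  simp only [liftDeriv]
  nlinarith [hα.1, hα.2]

theorem exists_lift_eq (hα : 0 < α) {y : ℝ} (hy : 0 ≤ y) : ∃ x ∈ Ici (0 : ℝ), lift α x = y := by
  have := intermediate_value_Icc hy (continuous_lift hα).continuousOn
  obtain ⟨x, hx, h⟩ := this ⟨(lift_zero hα).le.trans hy, le_lift hy⟩
  exact ⟨x, hx.1, h⟩

theorem lift_invLift (hα : 0 < α) {y : ℝ} (hy : 0 ≤ y) : lift α (invLift α y) = y :=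
  Function.invFunOn_eq (exists_lift_eq hα hy)

theorem invLift_nonneg (hα : 0 < α) {y : ℝ} (hy : 0 ≤ y) : 0 ≤ invLift α y :=
  Function.invFunOn_mem (exists_lift_eq hα hy)

theorem invLift_le_iff (hα : 0 < α) {x y : ℝ} (hx : 0 ≤ x) (hy : 0 ≤ y) :
    invLift α y ≤ x ↔ y ≤ lift α x := by
  rw [← (lift_strictMonoOn hα).le_iff_le (invLift_nonneg hα hy) hx, lift_invLift hα hy]

theorem lt_invLift_iff (hα : 0 < α) {x y : ℝ} (hx : 0 ≤ x) (hy : 0 ≤ y) :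
    x < invLift α y ↔ lift α x < y := by
  rw [← not_le, invLift_le_iff hα hx hy, not_le]

theorem le_invLift_iff (hα : 0 < α) {x y : ℝ} (hx : 0 ≤ x) (hy : 0 ≤ y) :
    x ≤ invLift α y ↔ lift α x ≤ y := by
  rw [← (lift_strictMonoOn hα).le_iff_le hx (invLift_nonneg hα hy), lift_invLift hα hy]

theorem invLift_mono (hα : 0 < α) {x y : ℝ} (hx : 0 ≤ x) (hxy : x ≤ y) :
    invLift α x ≤ invLift α y := by
  rw [invLift_le_iff hα (invLift_nonneg hα (hx.trans hxy)) hx, lift_invLift hα (hx.trans hxy)]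
  exact hxy

theorem invLift_zero (hα : 0 < α) : invLift α 0 = 0 :=
  le_antisymm ((invLift_le_iff hα le_rfl le_rfl).2 (lift_zero hα).ge) (invLift_nonneg hα le_rfl)

theorem invLift_two (hα : 0 < α) : invLift α 2 = 1 :=
  le_antisymm ((invLift_le_iff hα zero_le_one zero_le_two).2 lift_one.ge)
    ((le_invLift_iff hα zero_le_one zero_le_two).2 lift_one.le)

theorem invLift_le_self (hα : 0 < α) {x : ℝ} (hx : 0 ≤ x) : invLift α x ≤ x :=
  (invLift_le_iff hα hx hx).2 (le_lift hx)

/-- Superadditivity of `lift` turns into subadditivity of its inverse: an interval is pulled back to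
greatest length when it starts at `0`. -/
theorem invLift_sub_le (hα : 0 < α) {u v : ℝ} (hu : 0 ≤ u) (huv : u ≤ v) :
    invLift α v - invLift α u ≤ invLift α (v - u) := by
  rw [le_invLift_iff hα (sub_nonneg.2 (invLift_mono hα hu huv)) (sub_nonneg.2 huv)]
  have := lift_sub_le hα (invLift_nonneg hα hu) (invLift_mono hα hu huv)
  rwa [lift_invLift hα hu, lift_invLift hα (hu.trans huv)] at this

theorem concaveOn_invLift (hα : 0 < α) : ConcaveOn ℝ (Ici 0) (invLift α) := by
  refine ⟨convex_Ici 0, fun x hx y hy a b ha hb hab => ?_⟩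
  have hx' := invLift_nonneg hα hx
  have hy' := invLift_nonneg hα hy
  have h := (convexOn_lift hα).2 hx' hy' ha hb hab
  rw [lift_invLift hα hx, lift_invLift hα hy] at h
  refine (le_invLift_iff hα ?_ ((convex_Ici (0 : ℝ)) hx hy ha hb hab)).2 h
  exact (convex_Ici (0 : ℝ)) hx' hy' ha hb hab

end Lift

/-! ### Inverse branches, their distortion, and the decay of the zero cylinders -/

/-- The inverse branch of an iterate of the map that corresponds to a word. -/
def wordInv (α : ℝ) : List (Fin 2) → ℝ → ℝ
  | [], x => x
  | i :: l, x => invLift α (wordInv α l x + (i : ℕ))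

/-- The derivative of the inverse branch `wordInv`. -/
def wordDeriv (α : ℝ) : List (Fin 2) → ℝ → ℝ
  | [], _ => 1
  | i :: l, x => (liftDeriv α (wordInv α (i :: l) x))⁻¹ * wordDeriv α l x

/-- The right end point of the cylinder of the word `0 ⋯ 0` of length `n`. -/
def zeroEnd (α : ℝ) (n : ℕ) : ℝ := (invLift α)^[n] 1

/-- A bound for the logarithmic distortion of the `n`-th iterate on the `n`-cylinders. -/
def distortion (α : ℝ) (n : ℕ) : ℝ := ∑ j ∈ Finset.range n, 2 * zeroEnd α (j + 1) ^ α

section Word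

variable {α : ℝ}

theorem fin_two_cast_le (i : Fin 2) : ((i : ℕ) : ℝ) ≤ 1 := by
  exact_mod_cast Nat.lt_succ_iff.1 i.2

theorem fin_two_cast_nonneg (i : Fin 2) : (0 : ℝ) ≤ ((i : ℕ) : ℝ) := Nat.cast_nonneg _

theorem wordInv_mem (hα : 0 < α) (l : List (Fin 2)) {x : ℝ} (hx : x ∈ Icc (0 : ℝ) 1) :
    wordInv α l x ∈ Icc (0 : ℝ) 1 := by
  induction l with
  | nil => exact hx
  | cons i l ih =>
    have h0 : 0 ≤ wordInv α l x + (i : ℕ) := add_nonneg ih.1 (fin_two_cast_nonneg i)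
    refine ⟨invLift_nonneg hα h0, (invLift_mono hα h0 ?_).trans (invLift_two hα).le⟩
    linarith [ih.2, fin_two_cast_le i]

theorem wordInv_mono (hα : 0 < α) (l : List (Fin 2)) {x y : ℝ} (hx : x ∈ Icc (0 : ℝ) 1)
    (hxy : x ≤ y) : wordInv α l x ≤ wordInv α l y := by
  induction l with
  | nil => exact hxy
  | cons i l ih =>
    exact invLift_mono hα (add_nonneg (wordInv_mem hα l hx).1 (fin_two_cast_nonneg i))
      (add_le_add_left ih _)

theorem concaveOn_wordInv (hα : 0 < α) (l : List (Fin 2)) :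
    ConcaveOn ℝ (Icc (0 : ℝ) 1) (wordInv α l) := by
  induction l with
  | nil => exact concaveOn_id (convex_Icc 0 1)
  | cons i l ih =>
    refine ⟨convex_Icc 0 1, fun x hx y hy a b ha hb hab => ?_⟩
    have hx' := add_nonneg (wordInv_mem hα l hx).1 (fin_two_cast_nonneg i)
    have hy' := add_nonneg (wordInv_mem hα l hy).1 (fin_two_cast_nonneg i)
    refine ((concaveOn_invLift hα).2 hx' hy' ha hb hab).trans ?_
    refine invLift_mono hα ((convex_Ici (0 : ℝ)) hx' hy' ha hb hab) ?_
    have := ih.2 hx hy ha hb hab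
    simp only [smul_eq_mul] at this ⊢
    have e : ((i : ℕ) : ℝ) = a * (i : ℕ) + b * (i : ℕ) := by rw [← add_mul, hab, one_mul]
    linarith

theorem wordInv_append (l l' : List (Fin 2)) (x : ℝ) :
    wordInv α (l ++ l') x = wordInv α l (wordInv α l' x) := by
  induction l with
  | nil => rfl
  | cons i l ih => simp [wordInv, ih]

theorem wordDeriv_append (l l' : List (Fin 2)) (x : ℝ) :
    wordDeriv α (l ++ l') x = wordDeriv α l (wordInv α l' x) * wordDeriv α l' x := by
  induction l with
  | nil => simp [wordDeriv]
  | cons i l ih =>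
    simp only [List.cons_append, wordDeriv, ih, mul_assoc]
    simp only [wordInv, wordInv_append]

theorem wordDeriv_pos (hα : 0 < α) (l : List (Fin 2)) {x : ℝ} (hx : x ∈ Icc (0 : ℝ) 1) :
    0 < wordDeriv α l x := by
  induction l with
  | nil => exact zero_lt_one
  | cons i l ih => exact mul_pos (inv_pos.2 (liftDeriv_pos hα (wordInv_mem hα _ hx).1)) ih

theorem wordDeriv_anti (hα : 0 < α) (l : List (Fin 2)) {x y : ℝ} (hx : x ∈ Icc (0 : ℝ) 1)
    (hy : y ∈ Icc (0 : ℝ) 1) (hxy : x ≤ y) : wordDeriv α l y ≤ wordDeriv α l x := by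
  induction l with
  | nil => exact le_rfl
  | cons i l ih =>
    have hx' := (wordInv_mem hα (i :: l) hx).1
    refine mul_le_mul ?_ ih (wordDeriv_pos hα l hy).le (inv_nonneg.2 (liftDeriv_pos hα hx').le)
    exact inv_anti₀ (liftDeriv_pos hα hx')
      (liftDeriv_mono hα hx' (wordInv_mono hα _ hx hxy))

theorem lift_wordInv_cons (hα : 0 < α) (i : Fin 2) (l : List (Fin 2)) {x : ℝ}
    (hx : x ∈ Icc (0 : ℝ) 1) : lift α (wordInv α (i :: l) x) = wordInv α l x + (i : ℕ) :=
  lift_invLift hα (add_nonneg (wordInv_mem hα l hx).1 (fin_two_cast_nonneg i))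

theorem wordInv_sub_le (hα : 0 < α) (l : List (Fin 2)) {x y : ℝ} (hx : x ∈ Icc (0 : ℝ) 1)
    (hy : y ∈ Icc (0 : ℝ) 1) (hxy : x ≤ y) :
    wordInv α l y - wordInv α l x ≤ wordDeriv α l x * (y - x) := by
  induction l with
  | nil => simp [wordInv, wordDeriv]
  | cons i l ih =>
    have hx' := (wordInv_mem hα (i :: l) hx).1
    have h := liftDeriv_mul_le hα hx' (wordInv_mono hα (i :: l) hx hxy)
    rw [lift_wordInv_cons hα i l hx, lift_wordInv_cons hα i l hy] at h
    rw [wordDeriv, mul_assoc, ← div_eq_inv_mul, le_div_iff₀ (liftDeriv_pos hα hx')]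
    linarith

theorem le_wordInv_sub (hα : 0 < α) (l : List (Fin 2)) {x y : ℝ} (hx : x ∈ Icc (0 : ℝ) 1)
    (hy : y ∈ Icc (0 : ℝ) 1) (hxy : x ≤ y) :
    wordDeriv α l y * (y - x) ≤ wordInv α l y - wordInv α l x := by
  induction l with
  | nil => simp [wordInv, wordDeriv]
  | cons i l ih =>
    have hx' := (wordInv_mem hα (i :: l) hx).1
    have hy' := (wordInv_mem hα (i :: l) hy).1
    have h := le_liftDeriv_mul hα hx' (wordInv_mono hα (i :: l) hx hxy)
    rw [lift_wordInv_cons hα i l hx, lift_wordInv_cons hα i l hy] at h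
    rw [wordDeriv, mul_assoc, ← div_eq_inv_mul, div_le_iff₀ (liftDeriv_pos hα hy')]
    linarith

theorem zeroEnd_zero : zeroEnd α 0 = 1 := rfl

theorem zeroEnd_succ (n : ℕ) : zeroEnd α (n + 1) = invLift α (zeroEnd α n) :=
  Function.iterate_succ_apply' _ _ _

theorem zeroEnd_pos (hα : 0 < α) (n : ℕ) : 0 < zeroEnd α n := by
  induction n with
  | zero => exact zero_lt_one
  | succ n ih =>
    rw [zeroEnd_succ, lt_invLift_iff hα le_rfl ih.le, lift_zero hα]
    exact ih

theorem lift_zeroEnd_succ (hα : 0 < α) (n : ℕ) : lift α (zeroEnd α (n + 1)) = zeroEnd α n := by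
  rw [zeroEnd_succ, lift_invLift hα (zeroEnd_pos hα n).le]

theorem zeroEnd_antitone (hα : 0 < α) : Antitone (zeroEnd α) := by
  refine antitone_nat_of_succ_le fun n => ?_
  rw [zeroEnd_succ]
  exact invLift_le_self hα (zeroEnd_pos hα n).le

theorem zeroEnd_le_one (hα : 0 < α) (n : ℕ) : zeroEnd α n ≤ 1 :=
  zeroEnd_antitone hα (Nat.zero_le n)

theorem zeroEnd_mem (hα : 0 < α) (n : ℕ) : zeroEnd α n ∈ Icc (0 : ℝ) 1 :=
  ⟨(zeroEnd_pos hα n).le, zeroEnd_le_one hα n⟩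

theorem tendsto_zeroEnd (hα : 0 < α) : Tendsto (zeroEnd α) atTop (𝓝 0) := by
  have h := tendsto_atTop_ciInf (zeroEnd_antitone hα)
    ⟨0, by rintro _ ⟨n, rfl⟩; exact (zeroEnd_pos hα n).le⟩
  set z := ⨅ i, zeroEnd α i
  have hz : 0 ≤ z := ge_of_tendsto' h fun n => (zeroEnd_pos hα n).le
  have h1 := (continuous_lift hα).continuousAt.tendsto.comp ((tendsto_add_atTop_iff_nat 1).2 h)
  have h2 : lift α z = z := tendsto_nhds_unique (h1.congr (lift_zeroEnd_succ hα)) h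
  have h3 : z ^ (1 + α) = 0 := by simpa [lift] using h2
  rwa [(Real.rpow_eq_zero hz (by linarith)).1 h3] at h

theorem wordInv_replicate_zero (k : ℕ) (x : ℝ) :
    wordInv α (List.replicate k 0) x = (invLift α)^[k] x := by
  induction k with
  | zero => rfl
  | succ k ih =>
    rw [List.replicate_succ, wordInv, ih, Function.iterate_succ_apply']
    simp

theorem wordInv_replicate_zero_zero (hα : 0 < α) (k : ℕ) :
    wordInv α (List.replicate k 0) 0 = 0 := by
  rw [wordInv_replicate_zero, Function.iterate_fixed (invLift_zero hα)]

theorem wordInv_replicate_zero_one (k : ℕ) :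
    wordInv α (List.replicate k 0) 1 = zeroEnd α k := wordInv_replicate_zero k 1

/-- By `invLift_sub_le`, the cylinder at the neutral fixed point is the longest of its generation,
so cylinder lengths tend to `0` uniformly. -/
theorem wordInv_one_sub_le (hα : 0 < α) (l : List (Fin 2)) :
    wordInv α l 1 - wordInv α l 0 ≤ zeroEnd α l.length := by
  have h0 : (0 : ℝ) ∈ Icc (0 : ℝ) 1 := by simp
  have h1 : (1 : ℝ) ∈ Icc (0 : ℝ) 1 := by simp
  induction l with
  | nil => simp [wordInv, zeroEnd_zero]
  | cons i l ih =>
    rw [List.length_cons, zeroEnd_succ]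
    have hm := wordInv_mono hα l h0 zero_le_one
    refine (invLift_sub_le hα (add_nonneg (wordInv_mem hα l h0).1 (fin_two_cast_nonneg i))
      (add_le_add_left hm _)).trans (invLift_mono hα ?_ ?_) <;> linarith

theorem wordDeriv_zero_le (hα : α ∈ Ioo (0 : ℝ) 1) (l : List (Fin 2)) :
    wordDeriv α l 0 ≤ Real.exp (distortion α l.length) * wordDeriv α l 1 := by
  have h0 : (0 : ℝ) ∈ Icc (0 : ℝ) 1 := by simp
  have h1 : (1 : ℝ) ∈ Icc (0 : ℝ) 1 := by simp
  induction l with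
  | nil => simp [wordDeriv, distortion]
  | cons i l ih =>
    have ha := (wordInv_mem hα.1 (i :: l) h0).1
    have hab := wordInv_mono hα.1 (i :: l) h0 zero_le_one
    have hlen := wordInv_one_sub_le hα.1 (i :: l)
    have hd := liftDeriv_sub_le hα ha hab
    have hr := Real.rpow_le_rpow (sub_nonneg.2 hab) hlen hα.1.le
    have hpa := liftDeriv_pos hα.1 ha
    have hpb := liftDeriv_pos hα.1 (ha.trans hab)
    have hone := one_le_liftDeriv hα.1 ha
    simp only [wordDeriv]
    generalize wordInv α (i :: l) 0 = a at *
    generalize wordInv α (i :: l) 1 = b at *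
    rw [List.length_cons] at *
    have hc := Real.rpow_nonneg (zeroEnd_pos hα.1 (l.length + 1)).le α
    -- As `liftDeriv α a ≥ 1`, the additive Hölder error is also a relative one: `liftDeriv α b ≤
    -- liftDeriv α a * (1 + 2 * c ^ α)`.
    have key : (liftDeriv α a)⁻¹ ≤
        Real.exp (2 * zeroEnd α (l.length + 1) ^ α) * (liftDeriv α b)⁻¹ := by
      rw [← div_eq_mul_inv, le_div_iff₀ hpb, inv_mul_le_iff₀ hpa]
      have he := Real.add_one_le_exp (2 * zeroEnd α (l.length + 1) ^ α)
      have : liftDeriv α a * (2 * zeroEnd α (l.length + 1) ^ α + 1) ≤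
        liftDeriv α a * Real.exp (2 * zeroEnd α (l.length + 1) ^ α) :=
        mul_le_mul_of_nonneg_left he hpa.le
      nlinarith
    rw [distortion, Finset.sum_range_succ, add_comm (Finset.sum _ _), Real.exp_add]
    refine (mul_le_mul key ih (wordDeriv_pos hα.1 l h0).le ?_).trans (le_of_eq ?_)
    · exact mul_nonneg (Real.exp_pos _).le (inv_pos.2 hpb).le
    · rw [distortion]; ring

/-- The ratio of consecutive end points is `1 + c ^ α`, whose logarithm is at most `c ^ α`. Thus the
factor `1 / c_n` in the upper measure bound costs no more than the distortion. -/
theorem neg_log_zeroEnd_le (hα : 0 < α) (n : ℕ) : -Real.log (zeroEnd α n) ≤ distortion α n := by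
  induction n with
  | zero => simp [zeroEnd_zero, distortion]
  | succ n ih =>
    have hp := zeroEnd_pos hα (n + 1)
    have e : zeroEnd α n = zeroEnd α (n + 1) * (1 + zeroEnd α (n + 1) ^ α) := by
      rw [← lift_zeroEnd_succ hα n, lift, Real.rpow_add hp, Real.rpow_one]; ring
    have hc := Real.rpow_nonneg hp.le α
    have hl := Real.log_le_sub_one_of_pos (by linarith : 0 < 1 + zeroEnd α (n + 1) ^ α)
    rw [e, Real.log_mul hp.ne' (by linarith)] at ih
    rw [distortion, Finset.sum_range_succ, ← distortion]
    linarith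

/-- A Cesàro mean of terms tending to `0`; no rate for `zeroEnd` is needed. -/
theorem tendsto_distortion_div (hα : 0 < α) :
    Tendsto (fun n : ℕ => distortion α n / n) atTop (𝓝 0) := by
  have h : Tendsto (fun n => 2 * zeroEnd α (n + 1) ^ α) atTop (𝓝 0) := by
    have := ((tendsto_add_atTop_iff_nat 1).2 (tendsto_zeroEnd hα)).rpow_const (p := α)
      (Or.inr hα.le)
    rw [Real.zero_rpow hα.ne'] at this
    simpa using this.const_mul 2
  simpa [distortion, div_eq_inv_mul] using h.cesaro

/-- Each step raises `c_n ^ (-α)` by at most `1`: with `t = c_{n+1} ^ α`, the increment is at most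
`1/t - 1/(t(1+t)) = 1/(1+t)`, because `(1+t) ^ α ≤ 1+t`. -/
theorem zeroEnd_rpow_neg_le (hα : α ∈ Ioo (0 : ℝ) 1) (n : ℕ) :
    zeroEnd α n ^ (-α) ≤ 1 + n := by
  induction n with
  | zero => simp [zeroEnd_zero]
  | succ n ih =>
    have hp := zeroEnd_pos hα.1 (n + 1)
    have hc := Real.rpow_pos_of_pos hp α
    have e : zeroEnd α n = zeroEnd α (n + 1) * (1 + zeroEnd α (n + 1) ^ α) := by
      rw [← lift_zeroEnd_succ hα.1 n, lift, Real.rpow_add hp, Real.rpow_one]; ring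
    have hpow : (1 + zeroEnd α (n + 1) ^ α) ^ α ≤ 1 + zeroEnd α (n + 1) ^ α :=
      (Real.rpow_le_rpow_of_exponent_le (by linarith) hα.2.le).trans (Real.rpow_one _).le
    have hposw : 0 < (1 + zeroEnd α (n + 1) ^ α) ^ α := Real.rpow_pos_of_pos (by linarith) α
    rw [Real.rpow_neg (zeroEnd_pos hα.1 n).le, e, Real.mul_rpow hp.le (by linarith)] at ih
    rw [Real.rpow_neg hp.le]
    push_cast
    generalize zeroEnd α (n + 1) ^ α = t at *
    generalize (1 + t) ^ α = w at *
    have h2 : (t * (1 + t))⁻¹ ≤ (t * w)⁻¹ := by gcongr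
    have h3 : t⁻¹ = (t * (1 + t))⁻¹ + (1 + t)⁻¹ := by field_simp
    have h4 : (1 + t)⁻¹ ≤ 1 := inv_le_one_of_one_le₀ (by linarith)
    linarith

theorem le_zeroEnd (hα : α ∈ Ioo (0 : ℝ) 1) (n : ℕ) :
    ((1 : ℝ) + n) ^ (-(1 / α)) ≤ zeroEnd α n := by
  have hp := zeroEnd_pos hα.1 n
  have h := Real.rpow_le_rpow_of_nonpos (Real.rpow_pos_of_pos hp _) (zeroEnd_rpow_neg_le hα n)
    (by have := one_div_pos.2 hα.1; linarith : -(1 / α) ≤ 0)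
  rwa [← Real.rpow_mul hp.le, neg_mul_neg, mul_one_div_cancel hα.1.ne', Real.rpow_one] at h

end Word

/-! ### Cylinders as images of inverse branches -/

section Symbolic

variable {α : ℝ}

theorem mpMap_mem_Ico (x : ℝ) : mpMap α x ∈ Ico (0 : ℝ) 1 :=
  ⟨Int.fract_nonneg _, Int.fract_lt_one _⟩

/-- The point `1` must be left out: its lift is `2`, while its image is `0` and its symbol is `1`.
This is why half-open intervals are used throughout. -/
theorem lift_eq_code_add (hα : 0 < α) {x : ℝ} (hx : x ∈ Ico (0 : ℝ) 1) :
    lift α x = mpMap α x + ((code α x 0 : Fin 2) : ℕ) := by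
  have h0 : 0 ≤ lift α x := hx.1.trans (le_lift hx.1)
  have h2 : lift α x < 2 := lift_one (α := α) ▸ lift_strictMonoOn hα hx.1 (zero_le_one' ℝ) hx.2
  change lift α x = Int.fract (lift α x) + ((if lift α x < 1 then 0 else 1 : Fin 2) : ℕ)
  split_ifs with h
  · simp [Int.fract_eq_self.2 ⟨h0, h⟩]
  · have : Int.fract (lift α x) = lift α x - 1 := by
      rw [Int.fract_eq_iff]
      exact ⟨by linarith, by linarith, 1, by simp⟩
    simp [this]

theorem mem_Ico_wordInv_iff (hα : 0 < α) (l : List (Fin 2)) {x u v : ℝ}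
    (hx : x ∈ Ico (0 : ℝ) 1) (hu : u ∈ Icc (0 : ℝ) 1) (hv : v ∈ Icc (0 : ℝ) 1) :
    x ∈ Ico (wordInv α l u) (wordInv α l v) ↔
      (∀ k (h : k < l.length), code α x k = l[k]) ∧ (mpMap α)^[l.length] x ∈ Ico u v := by
  induction l generalizing x with
  | nil => simp [wordInv]
  | cons i l ih =>
    have hu' := wordInv_mem hα l hu
    have hv' := wordInv_mem hα l hv
    have hl := lift_eq_code_add hα hx
    have hT := mpMap_mem_Ico (α := α) x
    have e : x ∈ Ico (wordInv α (i :: l) u) (wordInv α (i :: l) v) ↔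
        code α x 0 = i ∧ mpMap α x ∈ Ico (wordInv α l u) (wordInv α l v) := by
      simp only [mem_Ico, wordInv]
      rw [invLift_le_iff hα hx.1 (add_nonneg hu'.1 (fin_two_cast_nonneg i)),
        lt_invLift_iff hα hx.1 (add_nonneg hv'.1 (fin_two_cast_nonneg i)), hl]
      generalize code α x 0 = j
      constructor
      · rintro ⟨h1, h2⟩
        have hij : j = i := by
          have a1 : ((i : ℕ) : ℝ) < (j : ℕ) + 1 := by linarith [hu'.1, hT.2]
          have a2 : ((j : ℕ) : ℝ) < (i : ℕ) + 1 := by linarith [hv'.2, hT.1]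
          norm_cast at a1 a2
          exact Fin.ext (by omega)
        subst hij
        exact ⟨rfl, by linarith, by linarith⟩
      · rintro ⟨rfl, h1, h2⟩
        exact ⟨by linarith, by linarith⟩
    rw [e, ih hT]
    simp only [List.length_cons, Function.iterate_succ_apply]
    constructor
    · rintro ⟨h0, h, h'⟩
      refine ⟨fun k hk => ?_, h'⟩
      cases k with
      | zero => exact h0
      | succ k => exact h k (by omega)
    · rintro ⟨h, h'⟩
      exact ⟨h 0 (by omega), fun k hk => h (k + 1) (by omega), h'⟩

theorem mem_Ico_wordInv_ofFn_iff (hα : 0 < α) {n : ℕ} (a : Fin n → Fin 2) {x u v : ℝ}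
    (hx : x ∈ Ico (0 : ℝ) 1) (hu : u ∈ Icc (0 : ℝ) 1) (hv : v ∈ Icc (0 : ℝ) 1) :
    x ∈ Ico (wordInv α (List.ofFn a) u) (wordInv α (List.ofFn a) v) ↔
      (∀ k : Fin n, code α x k = a k) ∧ (mpMap α)^[n] x ∈ Ico u v := by
  rw [mem_Ico_wordInv_iff hα _ hx hu hv]
  simp only [List.getElem_ofFn, List.length_ofFn]
  exact and_congr_left' ⟨fun h k => h k k.2, fun h k hk => h ⟨k, hk⟩⟩

theorem Ico_wordInv_subset (hα : 0 < α) (l : List (Fin 2)) {u v : ℝ}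
    (hu : u ∈ Icc (0 : ℝ) 1) (hv : v ∈ Icc (0 : ℝ) 1) :
    Ico (wordInv α l u) (wordInv α l v) ⊆ Ico 0 1 :=
  Ico_subset_Ico (wordInv_mem hα l hu).1 (wordInv_mem hα l hv).2

theorem cylinder_inter_Ico (hα : 0 < α) {n : ℕ} (a : Fin n → Fin 2) :
    cylinder α a ∩ Ico 0 1 = Ico (wordInv α (List.ofFn a) 0) (wordInv α (List.ofFn a) 1) := by
  have h0 : (0 : ℝ) ∈ Icc (0 : ℝ) 1 := by simp
  have h1 : (1 : ℝ) ∈ Icc (0 : ℝ) 1 := by simp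
  ext x
  constructor
  · rintro ⟨hc, hx⟩
    rw [mem_Ico_wordInv_ofFn_iff hα a hx h0 h1]
    refine ⟨(mem_cylinder_iff α a (Ico_subset_Icc_self hx)).1 hc, ?_⟩
    cases n with
    | zero => exact hx
    | succ n => rw [Function.iterate_succ_apply']; exact mpMap_mem_Ico _
  · intro h
    have hx := Ico_wordInv_subset hα _ h0 h1 h
    exact ⟨(mem_cylinder_iff α a (Ico_subset_Icc_self hx)).2
      ((mem_Ico_wordInv_ofFn_iff hα a hx h0 h1).1 h).1, hx⟩

theorem preimage_iterate_inter_Ico (hα : 0 < α) (n : ℕ) {u v : ℝ}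
    (hu : u ∈ Icc (0 : ℝ) 1) (hv : v ∈ Icc (0 : ℝ) 1) :
    (mpMap α)^[n] ⁻¹' Ico u v ∩ Ico 0 1 =
      ⋃ a : Fin n → Fin 2, Ico (wordInv α (List.ofFn a) u) (wordInv α (List.ofFn a) v) := by
  ext x
  simp only [mem_inter_iff, mem_preimage, mem_iUnion]
  constructor
  · rintro ⟨h, hx⟩
    exact ⟨fun k => code α x k, (mem_Ico_wordInv_ofFn_iff hα _ hx hu hv).2 ⟨fun _ => rfl, h⟩⟩
  · rintro ⟨a, ha⟩
    have hx := Ico_wordInv_subset hα _ hu hv ha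
    exact ⟨((mem_Ico_wordInv_ofFn_iff hα a hx hu hv).1 ha).2, hx⟩

theorem pairwise_disjoint_Ico_wordInv (hα : 0 < α) (n : ℕ) {u v : ℝ}
    (hu : u ∈ Icc (0 : ℝ) 1) (hv : v ∈ Icc (0 : ℝ) 1) :
    Pairwise (Function.onFun Disjoint fun a : Fin n → Fin 2 =>
      Ico (wordInv α (List.ofFn a) u) (wordInv α (List.ofFn a) v)) := by
  intro a b hab
  refine Set.disjoint_left.2 fun x ha hb => hab (funext fun k => ?_)
  have hx := Ico_wordInv_subset hα _ hu hv ha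
  rw [← ((mem_Ico_wordInv_ofFn_iff hα a hx hu hv).1 ha).1 k,
    ((mem_Ico_wordInv_ofFn_iff hα b hx hu hv).1 hb).1 k]

end Symbolic

/-! ### Invariance expressed through inverse branches -/

section Invariant

variable {α : ℝ} {μ : Measure ℝ}

theorem measure_inter_Ico (hac : μ ≪ volume.restrict (Icc (0 : ℝ) 1)) (s : Set ℝ) :
    μ (s ∩ Ico 0 1) = μ s := by
  refine measure_inter_conull ?_
  refine hac ?_
  rw [Measure.restrict_apply₀' measurableSet_Icc.nullMeasurableSet]
  refine measure_mono_null (t := {1}) ?_ (by simp)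
  rintro x ⟨hx', h1⟩
  by_contra hne
  exact hx' ⟨h1.1, lt_of_le_of_ne h1.2 hne⟩

theorem measure_cylinder (hα : 0 < α) (hac : μ ≪ volume.restrict (Icc (0 : ℝ) 1)) {n : ℕ}
    (a : Fin n → Fin 2) : μ (cylinder α a) =
      μ (Ico (wordInv α (List.ofFn a) 0) (wordInv α (List.ofFn a) 1)) := by
  rw [← measure_inter_Ico hac, cylinder_inter_Ico hα]

theorem measureReal_Ico_eq_sum [IsProbabilityMeasure μ] (hα : 0 < α)
    (hac : μ ≪ volume.restrict (Icc (0 : ℝ) 1)) (hinv : MeasurePreserving (mpMap α) μ μ) (n : ℕ)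
    {u v : ℝ} (hu : u ∈ Icc (0 : ℝ) 1) (hv : v ∈ Icc (0 : ℝ) 1) :
    μ.real (Ico u v) = ∑ a : Fin n → Fin 2,
      μ.real (Ico (wordInv α (List.ofFn a) u) (wordInv α (List.ofFn a) v)) := by
  have h := (hinv.iterate n).measure_preimage (measurableSet_Ico (a := u) (b := v)).nullMeasurableSet
  rw [← measure_inter_Ico hac, preimage_iterate_inter_Ico hα n hu hv,
    measure_iUnion (pairwise_disjoint_Ico_wordInv hα n hu hv) (fun _ => measurableSet_Ico),
    tsum_fintype] at h
  rw [measureReal_def, ← h, ENNReal.toReal_sum (fun _ _ => measure_ne_top _ _)]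
  rfl

end Invariant

/-! ### Concavity of the distribution function -/

section Concave

variable {α : ℝ} {μ : Measure ℝ}

/-- The distribution function of an absolutely continuous invariant probability is approximated by
distribution functions that are nonnegative combinations of inverse branches. -/
theorem exists_wordInv_approx [IsProbabilityMeasure μ] (hα : 0 < α)
    (hac : μ ≪ volume.restrict (Icc (0 : ℝ) 1)) (hinv : MeasurePreserving (mpMap α) μ μ)
    {ε : ℝ} (hε : 0 < ε) :
    ∃ (n : ℕ) (w : (Fin n → Fin 2) → ℝ), (∀ a, 0 ≤ w a) ∧ ∀ t ∈ Icc (0 : ℝ) 1,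
      |μ.real (Ico 0 t) - ∑ a : Fin n → Fin 2,
        w a * (wordInv α (List.ofFn a) t - wordInv α (List.ofFn a) 0)| ≤ ε + ε := by
  have hac' : μ ≪ (volume : Measure ℝ) := hac.trans Measure.restrict_le_self.absolutelyContinuous
  set h : ℝ → ℝ := fun x => (μ.rnDeriv volume x).toReal with hh
  have hint : Integrable h volume := Measure.integrable_toReal_rnDeriv
  obtain ⟨g, hgs, hgε, hgc, hgi⟩ := hint.exists_hasCompactSupport_integral_sub_le hε
  obtain ⟨δ, hδ, hg⟩ := Metric.uniformContinuous_iff.1 (hgs.uniformContinuous_of_continuous hgc) ε hε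
  obtain ⟨n, hn⟩ := ((tendsto_zeroEnd hα).eventually_lt_const hδ).exists
  have h0 : (0 : ℝ) ∈ Icc (0 : ℝ) 1 := by simp
  have h1 : (1 : ℝ) ∈ Icc (0 : ℝ) 1 := by simp
  -- The weight of a cylinder is the approximate density at its left end, truncated at `0` so that
  -- the combination stays concave.
  refine ⟨n, fun a => max (g (wordInv α (List.ofFn a) 0)) 0, fun a => le_max_right _ _,
    fun t ht => ?_⟩
  rw [measureReal_Ico_eq_sum hα hac hinv n h0 ht, ← Finset.sum_sub_distrib]
  have hnorm : Integrable (fun x => ‖h x - g x‖) volume := (hint.sub hgi).norm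
  have hdisj := pairwise_disjoint_Ico_wordInv hα n h0 ht
  have key : ∀ a : Fin n → Fin 2,
      |μ.real (Ico (wordInv α (List.ofFn a) 0) (wordInv α (List.ofFn a) t)) -
        max (g (wordInv α (List.ofFn a) 0)) 0 *
          (wordInv α (List.ofFn a) t - wordInv α (List.ofFn a) 0)| ≤
      ∫ x in Ico (wordInv α (List.ofFn a) 0) (wordInv α (List.ofFn a) t), (‖h x - g x‖ + ε) := by
    intro a
    have hle := wordInv_mono hα (List.ofFn a) h0 ht.1
    have hle1 := wordInv_mono hα (List.ofFn a) ht ht.2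
    have hlen := wordInv_one_sub_le hα (List.ofFn a)
    rw [List.length_ofFn] at hlen
    generalize wordInv α (List.ofFn a) 0 = p at *
    generalize wordInv α (List.ofFn a) t = r at *
    have hconst : max (g p) 0 * (r - p) = ∫ x in Ico p r, max (g p) 0 := by
      rw [setIntegral_const, Real.volume_real_Ico_of_le hle, smul_eq_mul, mul_comm]
    have hfin : volume (Ico p r) ≠ ∞ := by simp
    rw [← Measure.setIntegral_toReal_rnDeriv hac' (Ico p r), hconst,
      ← integral_sub hint.integrableOn (integrableOn_const hfin)]
    refine (abs_integral_le_integral_abs).trans ?_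
    refine setIntegral_mono_on ?_ ?_ measurableSet_Ico fun x hx => ?_
    · exact (hint.integrableOn.sub (integrableOn_const hfin)).abs
    · exact hnorm.integrableOn.add (integrableOn_const hfin)
    · have hd : |g x - g p| < ε := by
        refine hg ?_
        rw [Real.dist_eq, abs_of_nonneg (by linarith [hx.1])]
        linarith [hx.2]
      have hpos : 0 ≤ h x := ENNReal.toReal_nonneg
      -- Truncation does not increase the error, since the true density is nonnegative.
      have e1 : |h x - max (g p) 0| ≤ |h x - g p| := by
        rcases le_total (g p) 0 with hp | hp
        · rw [max_eq_right hp, abs_of_nonneg (by linarith), abs_of_nonneg (by linarith)]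
          linarith
        · rw [max_eq_left hp]
      refine e1.trans ((abs_sub_le _ (g x) _).trans ?_)
      rw [Real.norm_eq_abs]
      linarith
  -- The pieces are disjoint in `[0, 1)`: one `ε` is the `L¹` error, the other is the oscillation
  -- times a total length of at most `1`.
  refine (Finset.abs_sum_le_sum_abs _ _).trans ((Finset.sum_le_sum fun a _ => key a).trans ?_)
  have hIco : IntegrableOn (fun x => ‖h x - g x‖ + ε) (Ico 0 1) volume :=
    hnorm.integrableOn.add (integrableOn_const (by simp))
  rw [← integral_iUnion_fintype (fun a => measurableSet_Ico) hdisj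
    (fun a => hIco.mono_set (Ico_wordInv_subset hα _ h0 ht))]
  refine (setIntegral_mono_set hIco (ae_of_all _ fun x => by positivity)
    (LE.le.eventuallyLE (iUnion_subset fun a => Ico_wordInv_subset hα _ h0 ht))).trans ?_
  rw [integral_add hnorm.integrableOn (integrableOn_const (by simp)), setIntegral_const,
    Real.volume_real_Ico_of_le zero_le_one]
  refine add_le_add ((setIntegral_le_integral hnorm (ae_of_all _ fun x => norm_nonneg _)).trans hgε) ?_
  simp

theorem concaveOn_measureReal_Ico [IsProbabilityMeasure μ] (hα : 0 < α)
    (hac : μ ≪ volume.restrict (Icc (0 : ℝ) 1)) (hinv : MeasurePreserving (mpMap α) μ μ) :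
    ConcaveOn ℝ (Icc (0 : ℝ) 1) (fun t => μ.real (Ico 0 t)) := by
  refine ⟨convex_Icc 0 1, fun x hx y hy a b ha hb hab => le_of_forall_pos_le_add fun ε hε => ?_⟩
  obtain ⟨n, w, hw, happ⟩ := exists_wordInv_approx hα hac hinv (by linarith : 0 < ε / 4)
  set G : ℝ → ℝ := fun t => ∑ c : Fin n → Fin 2,
    w c * (wordInv α (List.ofFn c) t - wordInv α (List.ofFn c) 0) with hG
  have hz := (convex_Icc (0 : ℝ) 1) hx hy ha hb hab
  have hconc : a * G x + b * G y ≤ G (a • x + b • y) := by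
    simp only [hG, Finset.mul_sum, ← Finset.sum_add_distrib]
    refine Finset.sum_le_sum fun c _ => ?_
    have := mul_le_mul_of_nonneg_left
      ((concaveOn_wordInv hα (List.ofFn c)).2 hx hy ha hb hab) (hw c)
    simp only [smul_eq_mul] at this ⊢
    have e : w c * wordInv α (List.ofFn c) 0 =
      (a + b) * (w c * wordInv α (List.ofFn c) 0) := by rw [hab, one_mul]
    linarith
  have ex := abs_le.1 (happ x hx)
  have ey := abs_le.1 (happ y hy)
  have ez := abs_le.1 (happ _ hz)
  change _ ≤ _ - G x ∧ _ - G x ≤ _ at ex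
  change _ ≤ _ - G y ∧ _ - G y ≤ _ at ey
  change _ ≤ _ - G _ ∧ _ at ez
  simp only [smul_eq_mul] at *
  have h1 := mul_le_mul_of_nonneg_left (sub_le_iff_le_add.1 ex.2) ha
  have h2 := mul_le_mul_of_nonneg_left (sub_le_iff_le_add.1 ey.2) hb
  have e : (a + b) * (ε / 4 + ε / 4) = ε / 4 + ε / 4 := by rw [hab, one_mul]
  change _ ≤ μ.real (Ico 0 (a * x + b * y)) + ε
  linarith [ez.1]

end Concave

/-! ### Comparison of the measure with length and with branch derivatives -/

section Bounds

variable {α : ℝ} {μ : Measure ℝ}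

theorem measureReal_Ico_eq_sub [IsProbabilityMeasure μ] {u v : ℝ} (hu : 0 ≤ u) (huv : u ≤ v) :
    μ.real (Ico u v) = μ.real (Ico 0 v) - μ.real (Ico 0 u) := by
  rw [← Ico_union_Ico_eq_Ico hu huv, measureReal_union (Ico_disjoint_Ico_same) measurableSet_Ico]
  ring

theorem measureReal_Ico_zero_one [IsProbabilityMeasure μ]
    (hac : μ ≪ volume.restrict (Icc (0 : ℝ) 1)) : μ.real (Ico 0 1) = 1 := by
  rw [measureReal_def, ← univ_inter (Ico (0 : ℝ) 1), measure_inter_Ico hac]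
  simp

theorem tendsto_measureReal_Ico_zeroEnd [IsProbabilityMeasure μ] (hα : 0 < α)
    (hac : μ ≪ volume.restrict (Icc (0 : ℝ) 1)) :
    Tendsto (fun k => μ.real (Ico 0 (zeroEnd α k))) atTop (𝓝 0) := by
  have h : Tendsto (fun k => μ (Ico 0 (zeroEnd α k))) atTop
      (𝓝 (μ (⋂ k, Ico 0 (zeroEnd α k)))) :=
    tendsto_measure_iInter_atTop (fun k => measurableSet_Ico.nullMeasurableSet)
      (fun i j hij => Ico_subset_Ico_right (zeroEnd_antitone hα hij)) ⟨0, measure_ne_top _ _⟩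
  have h0 : μ (⋂ k, Ico 0 (zeroEnd α k)) = 0 := by
    refine measure_mono_null (t := {0}) (fun x hx => ?_) (hac (by simp))
    rw [mem_iInter] at hx
    exact le_antisymm (ge_of_tendsto' (tendsto_zeroEnd hα) fun k => (hx k).2.le) (hx 0).1
  rw [h0] at h
  exact (ENNReal.tendsto_toReal ENNReal.zero_ne_top).comp h

theorem le_wordDeriv (hα : α ∈ Ioo (0 : ℝ) 1) (l : List (Fin 2)) {x : ℝ}
    (hx : x ∈ Icc (0 : ℝ) 1) : (3⁻¹ : ℝ) ^ l.length ≤ wordDeriv α l x := by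
  induction l with
  | nil => simp [wordDeriv]
  | cons i l ih =>
    rw [List.length_cons, pow_succ']
    have hm := wordInv_mem hα.1 (i :: l) hx
    exact mul_le_mul (inv_anti₀ (liftDeriv_pos hα.1 hm.1) (liftDeriv_le_three hα hm)) ih
      (by positivity) (inv_nonneg.2 (liftDeriv_pos hα.1 hm.1).le)

/-- The left interval is one of the disjoint pieces of the preimage of `Ico u v`, which has the same
measure by invariance. -/
theorem measureReal_Ico_wordInv_le [IsProbabilityMeasure μ] (hα : 0 < α)
    (hac : μ ≪ volume.restrict (Icc (0 : ℝ) 1)) (hinv : MeasurePreserving (mpMap α) μ μ)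
    (l : List (Fin 2)) {u v : ℝ} (hu : u ∈ Icc (0 : ℝ) 1) (hv : v ∈ Icc (0 : ℝ) 1) :
    μ.real (Ico (wordInv α l u) (wordInv α l v)) ≤ μ.real (Ico u v) := by
  rw [measureReal_Ico_eq_sum hα hac hinv l.length hu hv]
  have := Finset.single_le_sum (f := fun a : Fin l.length → Fin 2 =>
      μ.real (Ico (wordInv α (List.ofFn a) u) (wordInv α (List.ofFn a) v)))
    (fun _ _ => measureReal_nonneg) (Finset.mem_univ l.get)
  simpa only [List.ofFn_get] using this

/-- An absolutely continuous invariant probability has a density that is bounded from below. -/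
theorem exists_le_measureReal_Ico [IsProbabilityMeasure μ] (hα : α ∈ Ioo (0 : ℝ) 1)
    (hac : μ ≪ volume.restrict (Icc (0 : ℝ) 1)) (hinv : MeasurePreserving (mpMap α) μ μ) :
    ∃ κ : ℝ, 0 < κ ∧ ∀ u v : ℝ, 0 ≤ u → u ≤ v → v ≤ 1 → κ * (v - u) ≤ μ.real (Ico u v) := by
  have hconc := concaveOn_measureReal_Ico hα.1 hac hinv
  have hone := measureReal_Ico_zero_one hac
  obtain ⟨k, hk⟩ := ((tendsto_measureReal_Ico_zeroEnd hα.1 hac).eventually_lt_const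
    zero_lt_one).exists
  have hk1 : zeroEnd α k < 1 := by
    refine lt_of_le_of_ne (zeroEnd_le_one hα.1 k) fun h => ?_
    rw [h, hone] at hk
    exact lt_irrefl _ hk
  have hs : 0 < 1 - μ.real (Ico 0 (zeroEnd α k)) := by linarith
  have small : ∀ u v : ℝ, 0 ≤ u → u ≤ v → v ≤ zeroEnd α k →
      (1 - μ.real (Ico 0 (zeroEnd α k))) * (v - u) ≤ μ.real (Ico u v) := by
    intro u v hu huv hv
    rcases huv.eq_or_lt with rfl | huv'
    · simp
    have hv1 : v < 1 := hv.trans_lt hk1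
    -- To the left of `c_k < 1`, the slope of `F` dominates that of the chord to `1`, which is at
    -- least `1 - F c_k > 0`.
    have h := hconc.slope_anti_adjacent (x := u) (y := v) (z := 1) ⟨hu, by linarith⟩ (by simp)
      huv' hv1
    simp only [hone] at h
    rw [measureReal_Ico_eq_sub hu huv]
    rw [le_div_iff₀ (sub_pos.2 huv')] at h
    refine le_trans (mul_le_mul_of_nonneg_right ?_ (sub_nonneg.2 huv)) h
    rw [le_div_iff₀ (sub_pos.2 hv1)]
    have hm : μ.real (Ico 0 v) ≤ μ.real (Ico 0 (zeroEnd α k)) :=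
      measureReal_mono (Ico_subset_Ico_right hv)
    have : 1 - v ≤ 1 := by linarith
    nlinarith
  refine ⟨(1 - μ.real (Ico 0 (zeroEnd α k))) * (3⁻¹ : ℝ) ^ k, by positivity,
    fun u v hu huv hv => ?_⟩
  have hum : u ∈ Icc (0 : ℝ) 1 := ⟨hu, huv.trans hv⟩
  have hvm : v ∈ Icc (0 : ℝ) 1 := ⟨hu.trans huv, hv⟩
  set l : List (Fin 2) := List.replicate k 0 with hl
  have h1 : (1 : ℝ) ∈ Icc (0 : ℝ) 1 := by simp
  -- The branch of `k` zeros moves any interval below `c_k`, without gaining measure and shrinking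
  -- length at most by `3 ^ k`.
  refine le_trans ?_ (measureReal_Ico_wordInv_le hα.1 hac hinv l hum hvm)
  refine le_trans ?_ (small _ _ (wordInv_mem hα.1 l hum).1 (wordInv_mono hα.1 l hum huv) ?_)
  · rw [mul_assoc]
    refine mul_le_mul_of_nonneg_left ?_ hs.le
    have h2 := le_wordInv_sub hα.1 l hum hvm huv
    have h3 := le_wordDeriv hα l hvm
    rw [hl, List.length_replicate, ← hl] at h3
    exact (mul_le_mul_of_nonneg_right h3 (sub_nonneg.2 huv)).trans h2
  · rw [← wordInv_replicate_zero_one]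
    exact wordInv_mono hα.1 l hvm hv

theorem wordInv_zero_lt_one (hα : 0 < α) (l : List (Fin 2)) :
    wordInv α l 0 < wordInv α l 1 := by
  have h1 : (1 : ℝ) ∈ Icc (0 : ℝ) 1 := by simp
  have h := le_wordInv_sub hα l (by simp : (0 : ℝ) ∈ Icc (0 : ℝ) 1) h1 zero_le_one
  have := wordDeriv_pos hα l h1
  linarith

/-- Away from the zero cylinder, a cylinder starts at some `u ≥ c_n`, where concavity bounds slopes
by `F u / u ≤ 1 / c_n`. For the zero cylinder the right side is `1`. -/
theorem measureReal_Ico_wordInv_le_div [IsProbabilityMeasure μ] (hα : 0 < α)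
    (hac : μ ≪ volume.restrict (Icc (0 : ℝ) 1)) (hinv : MeasurePreserving (mpMap α) μ μ) {n : ℕ}
    (a : Fin n → Fin 2) :
    μ.real (Ico (wordInv α (List.ofFn a) 0) (wordInv α (List.ofFn a) 1)) ≤
      (wordInv α (List.ofFn a) 1 - wordInv α (List.ofFn a) 0) / zeroEnd α n := by
  have h0 : (0 : ℝ) ∈ Icc (0 : ℝ) 1 := by simp
  have h1 : (1 : ℝ) ∈ Icc (0 : ℝ) 1 := by simp
  have hzero : List.ofFn (fun _ : Fin n => (0 : Fin 2)) = List.replicate n 0 := List.ofFn_const _ _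
  have hc := zeroEnd_pos hα n
  by_cases ha : a = fun _ => 0
  · rw [ha, hzero, wordInv_replicate_zero_zero hα, wordInv_replicate_zero_one, sub_zero,
      div_self hc.ne']
    exact measureReal_le_one
  have hlt := wordInv_zero_lt_one hα (List.ofFn a)
  have hdisj := pairwise_disjoint_Ico_wordInv hα n h0 h1 ha
  simp only [Function.onFun, hzero, wordInv_replicate_zero_zero hα,
    wordInv_replicate_zero_one] at hdisj
  have hmem := wordInv_mem hα (List.ofFn a) h0
  have hmem1 := wordInv_mem hα (List.ofFn a) h1
  generalize wordInv α (List.ofFn a) 0 = u at *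
  generalize wordInv α (List.ofFn a) 1 = v at *
  have hcu : zeroEnd α n ≤ u := by
    by_contra! h
    exact Set.disjoint_left.1 hdisj ⟨le_rfl, hlt⟩ ⟨hmem.1, h⟩
  have hu := hc.trans_le hcu
  have h := (concaveOn_measureReal_Ico hα hac hinv).slope_anti_adjacent h0 hmem1 hu hlt
  rw [measureReal_Ico_eq_sub hu.le hlt.le]
  rw [div_le_iff₀ (sub_pos.2 hlt)] at h
  refine h.trans ?_
  rw [mul_comm, div_eq_mul_inv (v - u)]
  refine mul_le_mul_of_nonneg_left ?_ (sub_pos.2 hlt).le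
  simp only [Ico_self, measureReal_empty, sub_zero]
  rw [div_le_iff₀ hu, inv_mul_eq_div, le_div_iff₀ hc]
  have : μ.real (Ico 0 u) ≤ 1 := measureReal_le_one
  nlinarith

/-- The measure of a cylinder agrees with the derivative of its inverse branch up to a factor that
is subexponential in the length. -/
theorem exists_abs_log_measureReal_sub_le [IsProbabilityMeasure μ] (hα : α ∈ Ioo (0 : ℝ) 1)
    (hac : μ ≪ volume.restrict (Icc (0 : ℝ) 1)) (hinv : MeasurePreserving (mpMap α) μ μ) :
    ∃ C : ℝ, ∀ (n : ℕ) (a : Fin n → Fin 2),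
      0 < μ.real (Ico (wordInv α (List.ofFn a) 0) (wordInv α (List.ofFn a) 1)) ∧
      |Real.log (μ.real (Ico (wordInv α (List.ofFn a) 0) (wordInv α (List.ofFn a) 1))) -
        Real.log (wordDeriv α (List.ofFn a) 0)| ≤ distortion α n + C := by
  obtain ⟨κ, hκ, hlow⟩ := exists_le_measureReal_Ico hα hac hinv
  refine ⟨|Real.log κ|, fun n a => ?_⟩
  have h0 : (0 : ℝ) ∈ Icc (0 : ℝ) 1 := by simp
  have h1 : (1 : ℝ) ∈ Icc (0 : ℝ) 1 := by simp
  have hlt := wordInv_zero_lt_one hα.1 (List.ofFn a)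
  have hup := measureReal_Ico_wordInv_le_div hα.1 hac hinv a
  have hlo := hlow _ _ (wordInv_mem hα.1 (List.ofFn a) h0).1 hlt.le
    (wordInv_mem hα.1 (List.ofFn a) h1).2
  have hs1 := wordInv_sub_le hα.1 (List.ofFn a) h0 h1 zero_le_one
  have hs2 := le_wordInv_sub hα.1 (List.ofFn a) h0 h1 zero_le_one
  have hd := wordDeriv_zero_le hα (List.ofFn a)
  have hd0 := wordDeriv_pos hα.1 (List.ofFn a) h0
  have hd1 := wordDeriv_pos hα.1 (List.ofFn a) h1
  have hc := zeroEnd_pos hα.1 n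
  have hcl := neg_log_zeroEnd_le hα.1 n
  rw [List.length_ofFn] at hd
  rw [sub_zero, mul_one] at hs1 hs2
  have hpos := (mul_pos hκ (sub_pos.2 hlt)).trans_le hlo
  refine ⟨hpos, abs_le.2 ⟨?_, ?_⟩⟩
  · have e1 := Real.log_le_log (mul_pos hκ hd1) ((mul_le_mul_of_nonneg_left hs2 hκ.le).trans hlo)
    have e2 := Real.log_le_log hd0 hd
    rw [Real.log_mul hκ.ne' hd1.ne'] at e1
    rw [Real.log_mul (Real.exp_pos _).ne' hd1.ne', Real.log_exp] at e2
    linarith [neg_abs_le (Real.log κ)]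
  · have e1 := Real.log_le_log hpos (hup.trans (div_le_div_of_nonneg_right hs1 hc.le))
    rw [Real.log_div hd0.ne' hc.ne'] at e1
    linarith [abs_nonneg (Real.log κ)]

end Bounds

/-! ### Infinite moments of hitting and return times -/

section Moments

variable {α : ℝ} {μ : Measure ℝ}

theorem ofReal_rpow_mul_measureReal_le_lintegral {X : Type*} [MeasurableSpace X] {ν : Measure X}
    [IsFiniteMeasure ν] {f : X → ℝ≥0∞} {S : Set X} (hS : MeasurableSet S) {k : ℕ}
    (hf : ∀ x ∈ S, ((k + 1 : ℕ) : ℝ≥0∞) ≤ f x) {q : ℝ} (hq : 0 ≤ q) :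
    ENNReal.ofReal (((1 : ℝ) + k) ^ q * ν.real S) ≤ ∫⁻ x, f x ^ q ∂ν := by
  have hk : (0 : ℝ) ≤ 1 + k := by positivity
  calc ENNReal.ofReal (((1 : ℝ) + k) ^ q * ν.real S)
      = ((k + 1 : ℕ) : ℝ≥0∞) ^ q * ν S := by
        rw [ENNReal.ofReal_mul (by positivity), ofReal_measureReal,
          ← ENNReal.ofReal_rpow_of_nonneg hk hq, ← ENNReal.ofReal_natCast]
        push_cast
        rw [add_comm]
    _ = ∫⁻ x in S, ((k + 1 : ℕ) : ℝ≥0∞) ^ q ∂ν := by rw [setLIntegral_const]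
    _ ≤ ∫⁻ x in S, f x ^ q ∂ν :=
        setLIntegral_mono' hS fun x hx => ENNReal.rpow_le_rpow (hf x hx) hq
    _ ≤ ∫⁻ x, f x ^ q ∂ν := setLIntegral_le_lintegral _ _

theorem eq_top_of_ofReal_mul_natCast_le {I : ℝ≥0∞} {c : ℝ} (hc : 0 < c)
    (h : ∀ k : ℕ, ENNReal.ofReal (c * k) ≤ I) : I = ⊤ := by
  have ht : Tendsto (fun k : ℕ => ENNReal.ofReal (c * k)) atTop (𝓝 ⊤) :=
    ENNReal.tendsto_ofReal_atTop.comp (tendsto_natCast_atTop_atTop.const_mul_atTop hc)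
  exact top_le_iff.1 (le_of_tendsto' ht h)

/-- The word `1 0 ⋯ 0` with `k` zeros. -/
def oneZeros (k : ℕ) : List (Fin 2) := 1 :: List.replicate k 0

theorem zeroEnd_div_three_le (hα : α ∈ Ioo (0 : ℝ) 1) (k : ℕ) :
    zeroEnd α k / 3 ≤ wordInv α (oneZeros k) 1 - wordInv α (oneZeros k) 0 := by
  have hc := zeroEnd_mem hα.1 k
  have h := le_wordInv_sub hα.1 [1] (by simp : (0 : ℝ) ∈ Icc (0 : ℝ) 1) hc hc.1
  have h2 := mul_le_mul_of_nonneg_right (le_wordDeriv hα [1] hc) hc.1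
  have e : ∀ x, wordInv α (oneZeros k) x = wordInv α [1] (wordInv α (List.replicate k 0) x) :=
    fun x => wordInv_append [1] _ x
  rw [e, e, wordInv_replicate_zero_zero hα.1, wordInv_replicate_zero_one]
  simp only [List.length_cons, List.length_nil, zero_add, pow_one, sub_zero] at h h2
  linarith

theorem exists_le_measureReal_oneZeros [IsProbabilityMeasure μ] (hα : α ∈ Ioo (0 : ℝ) 1)
    (hac : μ ≪ volume.restrict (Icc (0 : ℝ) 1)) (hinv : MeasurePreserving (mpMap α) μ μ) :
    ∃ c : ℝ, 0 < c ∧ ∀ k : ℕ,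
      c * zeroEnd α k ≤ μ.real (Ico (wordInv α (oneZeros k) 0) (wordInv α (oneZeros k) 1)) := by
  obtain ⟨κ, hκ, h⟩ := exists_le_measureReal_Ico hα hac hinv
  refine ⟨κ / 3, by positivity, fun k => ?_⟩
  refine le_trans ?_ (h _ _ (wordInv_mem hα.1 _ (by simp)).1
    (wordInv_zero_lt_one hα.1 _).le (wordInv_mem hα.1 _ (by simp)).2)
  have := mul_le_mul_of_nonneg_left (zeroEnd_div_three_le hα k) hκ.le
  linarith

/-- The preimage of `[0, c_k)` consists of `[0, c_{k+1})` and the cylinder `1 0 ⋯ 0`. -/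
theorem measureReal_Ico_zeroEnd_succ_add [IsProbabilityMeasure μ] (hα : 0 < α)
    (hac : μ ≪ volume.restrict (Icc (0 : ℝ) 1)) (hinv : MeasurePreserving (mpMap α) μ μ) (k : ℕ) :
    μ.real (Ico 0 (zeroEnd α k)) = μ.real (Ico 0 (zeroEnd α (k + 1))) +
      μ.real (Ico (wordInv α (oneZeros k) 0) (wordInv α (oneZeros k) 1)) := by
  have h := measureReal_Ico_eq_sum hα hac hinv 1 (by simp : (0 : ℝ) ∈ Icc (0 : ℝ) 1)
    (zeroEnd_mem hα k)
  rw [h, ← (Equiv.funUnique (Fin 1) (Fin 2)).symm.sum_comp, Fin.sum_univ_two]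
  simp [wordInv, oneZeros, wordInv_replicate_zero_zero hα, wordInv_replicate_zero_one,
    zeroEnd_succ, invLift_zero hα]

/-- Unfolding the recursion `k` times yields `k` cylinders, each of mass at least `c * c_{2k}` by
monotonicity. The gained factor `k` puts the critical hitting exponent one below the return
exponent. -/
theorem exists_le_measureReal_Ico_zeroEnd [IsProbabilityMeasure μ] (hα : α ∈ Ioo (0 : ℝ) 1)
    (hac : μ ≪ volume.restrict (Icc (0 : ℝ) 1)) (hinv : MeasurePreserving (mpMap α) μ μ) :
    ∃ c : ℝ, 0 < c ∧ ∀ k : ℕ, c * (k * zeroEnd α (2 * k)) ≤ μ.real (Ico 0 (zeroEnd α k)) := by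
  obtain ⟨c, hc, h⟩ := exists_le_measureReal_oneZeros hα hac hinv
  refine ⟨c, hc, fun k => ?_⟩
  have key : ∀ m, m ≤ k → c * (m * zeroEnd α (2 * k)) + μ.real (Ico 0 (zeroEnd α (k + m))) ≤
      μ.real (Ico 0 (zeroEnd α k)) := by
    intro m hm
    induction m with
    | zero => simp
    | succ m ih =>
      have ih := ih (by omega)
      rw [measureReal_Ico_zeroEnd_succ_add hα.1 hac hinv (k + m)] at ih
      have h1 := h (k + m)
      have h2 := mul_le_mul_of_nonneg_left
        (zeroEnd_antitone hα.1 (by omega : k + m ≤ 2 * k)) hc.le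
      push_cast
      rw [← add_assoc]
      linarith
  have := key k le_rfl
  linarith [measureReal_nonneg (μ := μ) (s := Ico 0 (zeroEnd α (k + k)))]

theorem code_zero_of_mem_oneZeros (hα : 0 < α) {k : ℕ} {x : ℝ}
    (hx : x ∈ Ico (wordInv α (oneZeros k) 0) (wordInv α (oneZeros k) 1)) : code α x 0 = 1 := by
  have h0 : (0 : ℝ) ∈ Icc (0 : ℝ) 1 := by simp
  have h1 : (1 : ℝ) ∈ Icc (0 : ℝ) 1 := by simp
  have h := ((mem_Ico_wordInv_iff hα _ (Ico_wordInv_subset hα _ h0 h1 hx) h0 h1).1 hx).1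
  exact h 0 (by simp [oneZeros])

theorem code_of_mem_oneZeros (hα : 0 < α) {k : ℕ} {x : ℝ}
    (hx : x ∈ Ico (wordInv α (oneZeros k) 0) (wordInv α (oneZeros k) 1)) {j : ℕ} (hj : 1 ≤ j)
    (hjk : j ≤ k) : code α x j = 0 := by
  have h0 : (0 : ℝ) ∈ Icc (0 : ℝ) 1 := by simp
  have h1 : (1 : ℝ) ∈ Icc (0 : ℝ) 1 := by simp
  have h := ((mem_Ico_wordInv_iff hα _ (Ico_wordInv_subset hα _ h0 h1 hx) h0 h1).1 hx).1
  obtain ⟨j, rfl⟩ := Nat.exists_eq_add_of_le' hj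
  simpa [oneZeros] using h (j + 1) (by simp [oneZeros]; omega)

theorem code_of_mem_Ico_zeroEnd (hα : 0 < α) {k : ℕ} {x : ℝ} (hx : x ∈ Ico 0 (zeroEnd α k))
    {j : ℕ} (hjk : j < k) : code α x j = 0 := by
  have h0 : (0 : ℝ) ∈ Icc (0 : ℝ) 1 := by simp
  have h1 : (1 : ℝ) ∈ Icc (0 : ℝ) 1 := by simp
  rw [← wordInv_replicate_zero_zero hα k, ← wordInv_replicate_zero_one] at hx
  have h := ((mem_Ico_wordInv_iff hα _ (Ico_wordInv_subset hα _ h0 h1 hx) h0 h1).1 hx).1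
  exact (h j (by simpa using hjk)).trans (List.getElem_replicate _)

/-- Only the first symbol matters: a `1` cannot be matched within the initial zeros of `y`. -/
theorem le_hittingTime (hα : 0 < α) {n : ℕ} (hn : 1 ≤ n) {k i : ℕ} {x y : ℝ}
    (hx : x ∈ Ico (wordInv α (oneZeros i) 0) (wordInv α (oneZeros i) 1))
    (hy : y ∈ Ico 0 (zeroEnd α k)) : ((k + 1 : ℕ) : ℝ≥0∞) ≤ hittingTime α n x y := by
  refine le_iInf₂ fun m hm => ?_
  have h := hm 0 hn
  rw [code_zero_of_mem_oneZeros hα hx] at h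
  have : k ≤ m := by
    by_contra! hlt
    rw [code_of_mem_Ico_zeroEnd hα hy (by simpa using hlt)] at h
    exact zero_ne_one h
  exact_mod_cast Nat.succ_le_succ this

theorem le_returnTime (hα : 0 < α) {n : ℕ} (hn : 1 ≤ n) {k : ℕ} {x : ℝ}
    (hx : x ∈ Ico (wordInv α (oneZeros k) 0) (wordInv α (oneZeros k) 1)) :
    ((k + 1 : ℕ) : ℝ≥0∞) ≤ returnTime α n x := by
  refine le_iInf₂ fun m hm => ?_
  have h := hm.2 0 hn
  rw [code_zero_of_mem_oneZeros hα hx] at h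
  have : k ≤ m := by
    by_contra! hlt
    rw [add_zero, code_of_mem_oneZeros hα hx hm.1 hlt.le] at h
    exact zero_ne_one h
  exact_mod_cast Nat.succ_le_succ this

theorem lintegral_hittingTime_eq_top [IsProbabilityMeasure μ] (hα : α ∈ Ioo (0 : ℝ) 1)
    (hac : μ ≪ volume.restrict (Icc (0 : ℝ) 1)) (hinv : MeasurePreserving (mpMap α) μ μ)
    {q : ℝ} (hq : 1 / α ≤ q) {n : ℕ} (hn : 1 ≤ n) :
    ∫⁻ p : ℝ × ℝ, hittingTime α n p.1 p.2 ^ q ∂(μ.prod μ) = ⊤ := by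
  obtain ⟨c, hc, h⟩ := exists_le_measureReal_Ico_zeroEnd hα hac hinv
  obtain ⟨c', hc', h'⟩ := exists_le_measureReal_oneZeros hα hac hinv
  have hα' : 0 < 1 / α := one_div_pos.2 hα.1
  have hA := (mul_pos hc' (zeroEnd_pos hα.1 0)).trans_le (h' 0)
  set A := Ico (wordInv α (oneZeros 0) 0) (wordInv α (oneZeros 0) 1)
  have h2 : 0 < (2 : ℝ) ^ (-(1 / α)) := by positivity
  refine eq_top_of_ofReal_mul_natCast_le
    (mul_pos (mul_pos hA hc) h2) fun k => ?_
  refine le_trans (ENNReal.ofReal_le_ofReal ?_) (ofReal_rpow_mul_measureReal_le_lintegral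
    (S := A ×ˢ Ico 0 (zeroEnd α k)) (k := k) (measurableSet_Ico.prod measurableSet_Ico)
    (fun p hp => le_hittingTime hα.1 hn hp.1 hp.2) (hα'.le.trans hq))
  rw [measureReal_prod_prod]
  have hk : (0 : ℝ) < 1 + k := by positivity
  have e1 : ((1 : ℝ) + k) ^ (1 / α) ≤ ((1 : ℝ) + k) ^ q :=
    Real.rpow_le_rpow_of_exponent_le (by simp) hq
  have e2 : (2 : ℝ) ^ (-(1 / α)) * ((1 : ℝ) + k) ^ (-(1 / α)) ≤ zeroEnd α (2 * k) := by
    rw [← Real.mul_rpow zero_le_two hk.le]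
    refine (Real.rpow_le_rpow_of_nonpos (by positivity) ?_ (by linarith)).trans (le_zeroEnd hα _)
    push_cast; linarith
  have e3 : ((1 : ℝ) + k) ^ (1 / α) * ((1 : ℝ) + k) ^ (-(1 / α)) = 1 := by
    rw [← Real.rpow_add hk]; simp
  calc μ.real A * c * 2 ^ (-(1 / α)) * k
      = ((1 : ℝ) + k) ^ (1 / α) *
        (μ.real A * (c * (k * (2 ^ (-(1 / α)) * ((1 : ℝ) + k) ^ (-(1 / α)))))) := by
        linear_combination (-(μ.real A * c * 2 ^ (-(1 / α)) * k)) * e3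
    _ ≤ ((1 : ℝ) + k) ^ q * (μ.real A * (c * (k * zeroEnd α (2 * k)))) := by gcongr
    _ ≤ _ := by gcongr; exact h k

theorem lintegral_returnTime_eq_top [IsProbabilityMeasure μ] (hα : α ∈ Ioo (0 : ℝ) 1)
    (hac : μ ≪ volume.restrict (Icc (0 : ℝ) 1)) (hinv : MeasurePreserving (mpMap α) μ μ)
    {q : ℝ} (hq : 1 / α + 1 ≤ q) {n : ℕ} (hn : 1 ≤ n) :
    ∫⁻ x, returnTime α n x ^ q ∂μ = ⊤ := by
  obtain ⟨c, hc, h⟩ := exists_le_measureReal_oneZeros hα hac hinv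
  have hα' : 0 < 1 / α := one_div_pos.2 hα.1
  refine eq_top_of_ofReal_mul_natCast_le hc fun k => ?_
  refine le_trans (ENNReal.ofReal_le_ofReal ?_) (ofReal_rpow_mul_measureReal_le_lintegral
    (k := k) measurableSet_Ico (fun x hx => le_returnTime hα.1 hn hx) (by linarith))
  have hk : (0 : ℝ) < 1 + k := by positivity
  have e1 : ((1 : ℝ) + k) ^ (1 / α + 1) ≤ ((1 : ℝ) + k) ^ q :=
    Real.rpow_le_rpow_of_exponent_le (by simp) hq
  have e3 : ((1 : ℝ) + k) ^ (1 / α + 1) * ((1 : ℝ) + k) ^ (-(1 / α)) = 1 + k := by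
    rw [← Real.rpow_add hk]; simp
  calc c * k ≤ c * (1 + k) := by gcongr; linarith
    _ = ((1 : ℝ) + k) ^ (1 / α + 1) * (c * ((1 : ℝ) + k) ^ (-(1 / α))) := by
      linear_combination (-c) * e3
    _ ≤ ((1 : ℝ) + k) ^ q * (c * zeroEnd α k) := by gcongr; exact le_zeroEnd hα k
    _ ≤ _ := by gcongr; exact h k

theorem log_top_div_natCast {n : ℕ} (hn : 1 ≤ n) : ENNReal.log ⊤ / ((n : ℕ) : EReal) = ⊤ := by
  rw [ENNReal.log_top]
  exact EReal.top_div_of_pos_ne_top (by exact_mod_cast hn) (EReal.natCast_ne_top n)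

end Moments

/-! ### Partition sums and the Rényi limit -/

theorem abs_log_sum_sub_log_sum_le {ι : Type*} [Fintype ι] [Nonempty ι] {f g : ι → ℝ}
    (hf : ∀ i, 0 < f i) (hg : ∀ i, 0 < g i) {B : ℝ}
    (h : ∀ i, |Real.log (f i) - Real.log (g i)| ≤ B) :
    |Real.log (∑ i, f i) - Real.log (∑ i, g i)| ≤ B := by
  have key : ∀ f g : ι → ℝ, (∀ i, 0 < f i) → (∀ i, 0 < g i) →
      (∀ i, |Real.log (f i) - Real.log (g i)| ≤ B) →
      Real.log (∑ i, f i) - Real.log (∑ i, g i) ≤ B := by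
    intro f g hf hg h
    have hfs : 0 < ∑ i, f i := Finset.sum_pos (fun i _ => hf i) Finset.univ_nonempty
    have hgs : 0 < ∑ i, g i := Finset.sum_pos (fun i _ => hg i) Finset.univ_nonempty
    have hle : ∑ i, f i ≤ Real.exp B * ∑ i, g i := by
      rw [Finset.mul_sum]
      refine Finset.sum_le_sum fun i _ => ?_
      rw [← Real.log_le_log_iff (hf i) (mul_pos (Real.exp_pos _) (hg i)),
        Real.log_mul (Real.exp_pos _).ne' (hg i).ne', Real.log_exp]
      linarith [(abs_le.1 (h i)).2]
    have := Real.log_le_log hfs hle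
    rw [Real.log_mul (Real.exp_pos _).ne' hgs.ne', Real.log_exp] at this
    linarith
  refine abs_le.2 ⟨?_, key f g hf hg h⟩
  linarith [key g f hg hf fun i => by rw [abs_sub_comm]; exact h i]

/-- The partition function `∑ (φ_a' 0) ^ s` over the inverse branches of the words of length `n`. -/
def partitionSum (α s : ℝ) (n : ℕ) : ℝ :=
  ∑ a : Fin n → Fin 2, wordDeriv α (List.ofFn a) 0 ^ s

section Partition

variable {α : ℝ} {μ : Measure ℝ}

theorem partitionSum_pos (hα : 0 < α) (s : ℝ) (n : ℕ) : 0 < partitionSum α s n :=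
  Finset.sum_pos (fun _ _ => Real.rpow_pos_of_pos (wordDeriv_pos hα _ (by simp)) s)
    Finset.univ_nonempty

theorem partitionSum_add (s : ℝ) (m n : ℕ) :
    partitionSum α s (m + n) = ∑ p : (Fin m → Fin 2) × (Fin n → Fin 2),
      (wordDeriv α (List.ofFn p.1) (wordInv α (List.ofFn p.2) 0) *
        wordDeriv α (List.ofFn p.2) 0) ^ s := by
  rw [partitionSum, ← (Fin.appendEquiv m n).sum_comp]
  refine Finset.sum_congr rfl fun p _ => ?_
  rw [← wordDeriv_append, ← List.ofFn_fin_append]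
  rfl

theorem partitionSum_mul (hα : 0 < α) (s : ℝ) (m n : ℕ) :
    partitionSum α s m * partitionSum α s n = ∑ p : (Fin m → Fin 2) × (Fin n → Fin 2),
      (wordDeriv α (List.ofFn p.1) 0 * wordDeriv α (List.ofFn p.2) 0) ^ s := by
  rw [partitionSum, partitionSum, Finset.sum_mul_sum, Fintype.sum_prod_type]
  refine Finset.sum_congr rfl fun a _ => Finset.sum_congr rfl fun b _ => ?_
  rw [Real.mul_rpow] <;> exact (wordDeriv_pos hα _ (by simp)).le

theorem wordDeriv_le_one (hα : 0 < α) (l : List (Fin 2)) {x : ℝ} (hx : x ∈ Icc (0 : ℝ) 1) :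
    wordDeriv α l x ≤ 1 := by
  induction l with
  | nil => exact le_rfl
  | cons i l ih =>
    exact mul_le_one₀ (inv_le_one_of_one_le₀ (one_le_liftDeriv hα (wordInv_mem hα _ hx).1))
      (wordDeriv_pos hα l hx).le ih

theorem abs_log_partitionSum_le (hα : α ∈ Ioo (0 : ℝ) 1) (s : ℝ) (n : ℕ) :
    |Real.log (partitionSum α s n)| ≤ n * (|s| * Real.log 3 + Real.log 2) := by
  have h0 : (0 : ℝ) ∈ Icc (0 : ℝ) 1 := by simp
  have h := abs_log_sum_sub_log_sum_le
    (f := fun a : Fin n → Fin 2 => wordDeriv α (List.ofFn a) 0 ^ s) (g := fun _ => 1)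
    (fun a => Real.rpow_pos_of_pos (wordDeriv_pos hα.1 _ h0) s) (fun _ => zero_lt_one)
    (B := |s| * (n * Real.log 3)) fun a => by
      have hp := wordDeriv_pos hα.1 (List.ofFn a) h0
      rw [Real.log_one, sub_zero, Real.log_rpow hp, abs_mul]
      refine mul_le_mul_of_nonneg_left ?_ (abs_nonneg s)
      rw [abs_of_nonpos (Real.log_nonpos hp.le (wordDeriv_le_one hα.1 _ h0))]
      have := Real.log_le_log (by positivity) (le_wordDeriv hα (List.ofFn a) h0)
      rw [Real.log_pow, Real.log_inv, List.length_ofFn] at this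
      linarith
  have hc : Real.log (∑ _ : Fin n → Fin 2, (1 : ℝ)) = n * Real.log 2 := by
    simp [Real.log_pow]
  rw [hc] at h
  change |Real.log (partitionSum α s n) - _| ≤ _ at h
  have h2 : 0 ≤ n * Real.log 2 := by positivity
  rw [abs_le] at h ⊢
  constructor <;> linarith [h.1, h.2]

/-- By the chain rule, the derivative of a concatenation at `0` is at most the product of the
derivatives at `0`. Taking powers gives submultiplicativity for `s ≥ 0` and supermultiplicativity
for `s ≤ 0`; Fekete's lemma handles both, with `hb` making the limit finite. -/
theorem exists_tendsto_log_partitionSum (hα : α ∈ Ioo (0 : ℝ) 1) (s : ℝ) :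
    ∃ M : ℝ, Tendsto (fun n : ℕ => Real.log (partitionSum α s n) / n) atTop (𝓝 M) := by
  have h0 : (0 : ℝ) ∈ Icc (0 : ℝ) 1 := by simp
  have hb : ∀ n : ℕ, |Real.log (partitionSum α s n) / n| ≤ |s| * Real.log 3 + Real.log 2 := by
    intro n
    rw [abs_div, Nat.abs_cast]
    refine div_le_of_le_mul₀ (Nat.cast_nonneg n) (by positivity) ?_
    rw [mul_comm]
    exact abs_log_partitionSum_le hα s n
  have hle : ∀ (m n : ℕ) (p : (Fin m → Fin 2) × (Fin n → Fin 2)),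
      wordDeriv α (List.ofFn p.1) (wordInv α (List.ofFn p.2) 0) * wordDeriv α (List.ofFn p.2) 0 ≤
        wordDeriv α (List.ofFn p.1) 0 * wordDeriv α (List.ofFn p.2) 0 := fun m n p =>
    mul_le_mul_of_nonneg_right (wordDeriv_anti hα.1 _ h0 (wordInv_mem hα.1 _ h0)
      (wordInv_mem hα.1 _ h0).1) (wordDeriv_pos hα.1 _ h0).le
  have hpos : ∀ (m n : ℕ) (p : (Fin m → Fin 2) × (Fin n → Fin 2)), 0 <
      wordDeriv α (List.ofFn p.1) (wordInv α (List.ofFn p.2) 0) * wordDeriv α (List.ofFn p.2) 0 :=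
    fun m n p => mul_pos (wordDeriv_pos hα.1 _ (wordInv_mem hα.1 _ h0)) (wordDeriv_pos hα.1 _ h0)
  rcases le_total 0 s with hs | hs
  · have hsub : Subadditive fun n => Real.log (partitionSum α s n) := by
      intro m n
      rw [← Real.log_mul (partitionSum_pos hα.1 s m).ne' (partitionSum_pos hα.1 s n).ne']
      refine Real.log_le_log (partitionSum_pos hα.1 s _) ?_
      rw [partitionSum_add, partitionSum_mul hα.1]
      exact Finset.sum_le_sum fun p _ => Real.rpow_le_rpow (hpos m n p).le (hle m n p) hs
    refine ⟨_, hsub.tendsto_lim ⟨-(|s| * Real.log 3 + Real.log 2), ?_⟩⟩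
    rintro _ ⟨n, rfl⟩
    exact (abs_le.1 (hb n)).1
  · have hsub : Subadditive fun n => -Real.log (partitionSum α s n) := by
      intro m n
      rw [← neg_add, neg_le_neg_iff,
        ← Real.log_mul (partitionSum_pos hα.1 s m).ne' (partitionSum_pos hα.1 s n).ne']
      refine Real.log_le_log (mul_pos (partitionSum_pos hα.1 s m) (partitionSum_pos hα.1 s n)) ?_
      rw [partitionSum_add, partitionSum_mul hα.1]
      exact Finset.sum_le_sum fun p _ =>
        Real.rpow_le_rpow_of_nonpos (hpos m n p) (hle m n p) hs
    have ht := (hsub.tendsto_lim ⟨-(|s| * Real.log 3 + Real.log 2), ?_⟩).neg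
    · refine ⟨_, ht.congr fun n => ?_⟩
      rw [neg_div, neg_neg]
    · rintro _ ⟨n, rfl⟩
      dsimp only
      rw [neg_div]
      exact neg_le_neg (abs_le.1 (hb n)).2

/-- The logarithm of a sum moves by at most the largest change in the logarithms of its terms, here
`|s| * (distortion α n + C) = o(n)`. -/
theorem exists_tendsto_log_sum_measureReal [IsProbabilityMeasure μ] (hα : α ∈ Ioo (0 : ℝ) 1)
    (hac : μ ≪ volume.restrict (Icc (0 : ℝ) 1)) (hinv : MeasurePreserving (mpMap α) μ μ) (s : ℝ) :
    ∃ M : ℝ, Tendsto (fun n : ℕ => Real.log (∑ a : Fin n → Fin 2,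
      μ.real (Ico (wordInv α (List.ofFn a) 0) (wordInv α (List.ofFn a) 1)) ^ s) / n)
      atTop (𝓝 M) := by
  obtain ⟨C, hC⟩ := exists_abs_log_measureReal_sub_le hα hac hinv
  obtain ⟨M, hM⟩ := exists_tendsto_log_partitionSum hα s
  refine ⟨M, ?_⟩
  have hbound : Tendsto (fun n : ℕ => |s| * (distortion α n / n + C / n)) atTop (𝓝 0) := by
    simpa using ((tendsto_distortion_div hα.1).add
      (tendsto_const_div_atTop_nhds_zero_nat C)).const_mul |s|
  have hdiff := squeeze_zero_norm (f := fun n : ℕ => Real.log (∑ a : Fin n → Fin 2,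
      μ.real (Ico (wordInv α (List.ofFn a) 0) (wordInv α (List.ofFn a) 1)) ^ s) / n -
      Real.log (partitionSum α s n) / n) (fun n => ?_) hbound
  · simpa using hdiff.add hM
  rw [← sub_div, ← add_div, Real.norm_eq_abs, abs_div, Nat.abs_cast, ← mul_div_assoc]
  refine div_le_div_of_nonneg_right (abs_log_sum_sub_log_sum_le
    (fun a => Real.rpow_pos_of_pos (hC n a).1 s)
    (fun a => Real.rpow_pos_of_pos (wordDeriv_pos hα.1 _ (by simp)) s) fun a => ?_)
    (Nat.cast_nonneg n)
  rw [Real.log_rpow (hC n a).1, Real.log_rpow (wordDeriv_pos hα.1 _ (by simp)), ← mul_sub, abs_mul]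
  exact mul_le_mul_of_nonneg_left (hC n a).2 (abs_nonneg s)

theorem exists_tendsto_renyiSpectrum [IsProbabilityMeasure μ] (hα : α ∈ Ioo (0 : ℝ) 1)
    (hac : μ ≪ volume.restrict (Icc (0 : ℝ) 1)) (hinv : MeasurePreserving (mpMap α) μ μ) (q : ℝ) :
    ∃ M : ℝ, Tendsto (fun n : ℕ => renyiSpectrum α μ n q) atTop (𝓝 (M : EReal)) := by
  obtain ⟨M, hM⟩ := exists_tendsto_log_sum_measureReal hα hac hinv (1 - q)
  obtain ⟨C, hC⟩ := exists_abs_log_measureReal_sub_le hα hac hinv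
  refine ⟨M, (EReal.tendsto_coe.2 hM).congr fun n => ?_⟩
  have hpos : 0 < ∑ a : Fin n → Fin 2,
      μ.real (Ico (wordInv α (List.ofFn a) 0) (wordInv α (List.ofFn a) 1)) ^ (1 - q) :=
    Finset.sum_pos (fun a _ => Real.rpow_pos_of_pos (hC n a).1 _) Finset.univ_nonempty
  have hsum : ∑ a : Fin n → Fin 2, μ (cylinder α a) ^ (1 - q) =
      ENNReal.ofReal (∑ a : Fin n → Fin 2,
        μ.real (Ico (wordInv α (List.ofFn a) 0) (wordInv α (List.ofFn a) 1)) ^ (1 - q)) := by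
    rw [ENNReal.ofReal_sum_of_nonneg fun a _ => Real.rpow_nonneg measureReal_nonneg _]
    refine Finset.sum_congr rfl fun a _ => ?_
    rw [measure_cylinder hα.1 hac, ← ENNReal.ofReal_rpow_of_pos (hC n a).1, ofReal_measureReal]
  rw [renyiSpectrum, hsum, ENNReal.log_ofReal_of_pos hpos, EReal.coe_div]
  rfl

end Partition

end

end MannevillePomeau


theorem mainTheorem12 (α : ℝ) (hα : α ∈ Set.Ioo (0 : ℝ) 1)
    (μ : Measure ℝ) [IsProbabilityMeasure μ]
    (hac : μ ≪ volume.restrict (Set.Icc (0 : ℝ) 1))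
    (hinv : MeasurePreserving (MannevillePomeau.mpMap α) μ μ) :
    (∀ q : ℝ, 1 / α ≤ q →
      (∀ n : ℕ, 1 ≤ n → MannevillePomeau.hittingSpectrum α μ n q = ⊤) ∧
      Tendsto (fun n : ℕ => MannevillePomeau.hittingSpectrum α μ n q) atTop (𝓝 ⊤)) ∧
    (∀ q : ℝ, ∃ M : ℝ,
      Tendsto (fun n : ℕ => MannevillePomeau.renyiSpectrum α μ n q) atTop (𝓝 (M : EReal))) ∧
    (∀ q : ℝ, 1 / α + 1 ≤ q →
      (∀ n : ℕ, 1 ≤ n → MannevillePomeau.returnSpectrum α μ n q = ⊤) ∧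
      Tendsto (fun n : ℕ => MannevillePomeau.returnSpectrum α μ n q) atTop (𝓝 ⊤)) := by
  refine ⟨fun q hq => ?_, MannevillePomeau.exists_tendsto_renyiSpectrum hα hac hinv,
    fun q hq => ?_⟩
  · have h : ∀ n : ℕ, 1 ≤ n → MannevillePomeau.hittingSpectrum α μ n q = ⊤ := fun n hn => by
      rw [MannevillePomeau.hittingSpectrum,
        MannevillePomeau.lintegral_hittingTime_eq_top hα hac hinv hq hn,
        MannevillePomeau.log_top_div_natCast hn]
    exact ⟨h, tendsto_const_nhds.congr' ((eventually_ge_atTop 1).mono fun n hn => (h n hn).symm)⟩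
  · have h : ∀ n : ℕ, 1 ≤ n → MannevillePomeau.returnSpectrum α μ n q = ⊤ := fun n hn => by
      rw [MannevillePomeau.returnSpectrum,
        MannevillePomeau.lintegral_returnTime_eq_top hα hac hinv hq hn,
        MannevillePomeau.log_top_div_natCast hn]
    exact ⟨h, tendsto_const_nhds.congr' ((eventually_ge_atTop 1).mono fun n hn => (h n hn).symm)⟩
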